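/- Let $\mathbb K$ be a field of characteristic $0$ and $\mathfrak g$ a finite-dimensional Lie algebra over $\mathbb K$ with radical $\mathfrak r$ and center $Z(\mathfrak g)$. Let $e(\mathrm{ad}\,\mathfrak g)$ be the smallest algebraic Lie subalgebra of $\mathfrak{gl}(\mathfrak g)$ containing $\mathrm{ad}\,\mathfrak g$ (algebraic means: the Lie algebra of an algebraic subgroup of $GL(\mathfrak g)$). Let $\Gamma$ be maximal among the Lie subalgebras of $e(\mathrm{ad}\,\mathfrak g)$ whose natural action on $\mathfrak g$ is semisimple, and let $(\mathfrak s,\mathfrak k,\mathfrak m)$ be a $\Gamma$-triple of $\mathfrak g$, that is: $\mathfrak s$ is a Levi subalgebra of $\mathfrak g$; $\mathfrak k$ is a nilpotent Lie subalgebra of $\mathfrak g$ with $[\mathfrak s,\mathfrak k]=0$; $\mathfrak m$ is a subspace of $\mathfrak r$ with $\mathfrak r=\mathfrak m\oplus\mathfrak k$ and $[\mathfrak s\oplus\mathfrak k,\mathfrak m]=\mathfrak m$ (so $\mathfrak g=\mathfrak s\oplus\mathfrak k\oplus\mathfrak m$); and $\Gamma=\mathrm{ad}\,\mathfrak s+(\mathrm{ad}\,\mathfrak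 k)|_{\mathrm S}$, where $(\mathrm{ad}\,\mathfrak k)|_{\mathrm S}$ is the set of semisimple Jordan components of the maps $\mathrm{ad}\,y$, $y\in\mathfrak k$. Let $\mu:\mathfrak k\to\mathfrak{gl}(\mathfrak m)$, $\mu(x)=\mathrm{ad}\,x|_{\mathfrak m}$. Let $\hat{\mathfrak n}$ be the Lie subalgebra of $\mathfrak g$ generated by $\mathfrak m$, let $(\mathrm{Der}\,\mathfrak g)^\Gamma$ be the Lie algebra of derivations of $\mathfrak g$ commuting with $\Gamma$, let $(\mathrm{Der}\,\hat{\mathfrak n})^\Gamma$ be the Lie algebra of derivations of $\hat{\mathfrak n}$ commuting with $\Gamma|_{\hat{\mathfrak n}}$, and let $\mathfrak B=(\mathrm{Der}\,\hat{\mathfrak n})^\Gamma|_{\mathfrak m}\subset\mathfrak{gl}(\mathfrak m)$ be the Lie algebra of restrictions of its elements to $\mathfrak m$. Then $\mu$ is injective if and only if $Z(\mathfrak g)=0$. Assume that $\mu$ is injective. Then $\mu(\mathfrak k)\subset\mathfrak B$; let $N=N_{\mathfrak B}(\mu(\mathfrak k))$ be the normalizer of $\mu(\mathfrak k)$ in $\mathfrak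 B$. The following hold. 1. The map $\Theta:\delta\mapsto\delta|_{\mathfrak m}$ is an isomorphism of Lie algebras of $(\mathrm{Der}\,\mathfrak g)^\Gamma$ onto $N$. 2. There is a Lie bracket $\Phi$ on the vector space $\mathfrak s\oplus N\oplus\mathfrak m$ such that, for $x_i\in\mathfrak s$, $y_i\in N$, $z_i\in\mathfrak m$, $$\Phi(x_1,x_2+y_2+z_2)=[x_1,x_2]+[x_1,z_2],\qquad \Phi(y_1,y_2+z_2)=(y_1y_2-y_2y_1)+y_1(z_2),\qquad \Phi(z_1,z_2)=\mu(k)+m,$$ where $k\in\mathfrak k$ and $m\in\mathfrak m$ are the projections of $[z_1,z_2]$ to $\mathfrak k$ and $\mathfrak m$; and the map $x+y+z\mapsto \mathrm{ad}\,x+\Theta^{-1}(y)+\mathrm{ad}\,z$ is an isomorphism of Lie algebras from $(\mathfrak s\oplus N\oplus\mathfrak m,\Phi)$ onto $\mathrm{Der}\,\mathfrak g$. 3. $\mathfrak g$ is complete (its center is trivial and all its derivations are inner) if and only if $\mu(\mathfrak k)=N$. -/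

import Mathlib

attribute [local instance 100] LieRing.ofAssociativeRing

namespace GammaDecomp

section Algebraic

variable {K V : Type*} [Field K] [AddCommGroup V] [Module K V]

/-- The value at `A` of a polynomial function on `gl(V)`. Polynomial functions on `gl(V)` are written
as polynomials in the linear forms on `gl(V)`. -/
noncomputable def polyEval (A : Module.End K V)
    (P : MvPolynomial (Module.Dual K (Module.End K V)) K) : K :=
  MvPolynomial.eval (fun φ => φ A) P

/-- `P` vanishes on the subgroup `G` of `GL(V)`. -/
def VanishesOn (G : Subgroup (LinearMap.GeneralLinearGroup K V))
    (P : MvPolynomial (Module.Dual K (Module.End K V)) K) : Prop :=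
  ∀ g ∈ G, polyEval (g : Module.End K V) P = 0

/-- `G` is an algebraic group: a subgroup of `GL(V)` which is the zero locus in `GL(V)` of a set of
polynomial functions. -/
def IsAlgebraicGroup (G : Subgroup (LinearMap.GeneralLinearGroup K V)) : Prop :=
  ∀ g : LinearMap.GeneralLinearGroup K V,
    (∀ P, VanishesOn G P → polyEval (g : Module.End K V) P = 0) → g ∈ G

/-- `X` is tangent to `G` at the identity: `P(1 + ε X) = 0` (with `ε² = 0`) for every polynomial
function `P` vanishing on `G`. -/
def IsTangent (G : Subgroup (LinearMap.GeneralLinearGroup K V)) (X : Module.End K V) : Prop :=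
  ∀ P, VanishesOn G P →
    MvPolynomial.aeval
      (fun φ : Module.Dual K (Module.End K V) =>
        (TrivSqZeroExt.inl (φ 1) + TrivSqZeroExt.inr (φ X) : DualNumber K)) P = 0

/-- A Lie subalgebra of `gl(V)` is algebraic if it is the Lie algebra of an algebraic group. -/
def IsAlgebraicLie (h : LieSubalgebra K (Module.End K V)) : Prop :=
  ∃ G : Subgroup (LinearMap.GeneralLinearGroup K V),
    IsAlgebraicGroup G ∧ ∀ X, X ∈ h ↔ IsTangent G X

/-- The algebraic hull of a Lie subalgebra of `gl(V)`: the smallest algebraic Lie subalgebra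
containing it. -/
def algHull (a : LieSubalgebra K (Module.End K V)) : LieSubalgebra K (Module.End K V) :=
  sInf {h | IsAlgebraicLie h ∧ a ≤ h}

/-- A Lie subalgebra of `gl(V)` is completely reducible if its natural action on `V` is
semisimple: every stable subspace has a stable complement. -/
def IsCompletelyReducible (Γ : LieSubalgebra K (Module.End K V)) : Prop :=
  ∀ W : Submodule K V, (∀ γ ∈ Γ, ∀ w ∈ W, γ w ∈ W) →
    ∃ W' : Submodule K V, (∀ γ ∈ Γ, ∀ w ∈ W', γ w ∈ W') ∧ IsCompl W W'

/-- `Γ` is maximal among the completely reducible Lie subalgebras contained in `e`. -/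
def IsMaximalCR (e Γ : LieSubalgebra K (Module.End K V)) : Prop :=
  Maximal (fun Δ : LieSubalgebra K (Module.End K V) => Δ ≤ e ∧ IsCompletelyReducible Δ) Γ

/-- `u` is the semisimple component of the Jordan decomposition of `f`. -/
def IsSemisimplePart (f u : Module.End K V) : Prop :=
  u.IsSemisimple ∧ IsNilpotent (f - u) ∧ Commute u (f - u)

end Algebraic

section Triple

variable {K L : Type*} [Field K] [LieRing L] [LieAlgebra K L]

/-- The Lie algebra `e(ad L)`. -/
noncomputable def eAd (K L : Type*) [Field K] [LieRing L] [LieAlgebra K L] :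
    LieSubalgebra K (Module.End K L) :=
  algHull (LieAlgebra.ad K L).range

/-- A Levi subalgebra: a semisimple subalgebra that is a vector space complement of the radical. -/
def IsLevi (s : LieSubalgebra K L) : Prop :=
  LieAlgebra.HasTrivialRadical K s ∧
    IsCompl s.toSubmodule (LieAlgebra.radical K L).toSubmodule

/-- `(s, k, m)` is the `Γ`-triple of `L`, where `Γ` is a maximal completely reducible subalgebra
of `e(ad L)`. The correspondence between `Γ` and the triple is `Γ = ad s + (ad k)|_S`, with
`(ad k)|_S` the set of semisimple components of the `ad y`, `y ∈ k`. The decomposition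
`L = s ⊕ k ⊕ m` follows from the fields `levi`, `disjoint` and `sup_eq`. -/
structure IsGammaTriple (Γ : LieSubalgebra K (Module.End K L))
    (s k : LieSubalgebra K L) (m : Submodule K L) : Prop where
  maximal : IsMaximalCR (eAd K L) Γ
  levi : IsLevi s
  nilpotent : LieRing.IsNilpotent k
  lie_s_k : ∀ x ∈ s, ∀ y ∈ k, ⁅x, y⁆ = 0
  disjoint : Disjoint m k.toSubmodule
  sup_eq : m ⊔ k.toSubmodule = (LieAlgebra.radical K L).toSubmodule
  span_lie : Submodule.span K
    {w | ∃ x ∈ s.toSubmodule ⊔ k.toSubmodule, ∃ y ∈ m, ⁅x, y⁆ = w} = m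
  mem_iff : ∀ T : Module.End K L, T ∈ Γ ↔
    ∃ x ∈ s, ∃ y ∈ k, ∃ u, IsSemisimplePart (LieAlgebra.ad K L y) u ∧ T = LieAlgebra.ad K L x + u

variable {Γ : LieSubalgebra K (Module.End K L)} {s k : LieSubalgebra K L} {m : Submodule K L}

namespace IsGammaTriple

theorem lie_s_m (T : IsGammaTriple Γ s k m) {x y : L} (hx : x ∈ s) (hy : y ∈ m) : ⁅x, y⁆ ∈ m := by
  have h : ⁅x, y⁆ ∈ Submodule.span K
      {w | ∃ x ∈ s.toSubmodule ⊔ k.toSubmodule, ∃ y ∈ m, ⁅x, y⁆ = w} :=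
    Submodule.subset_span ⟨x, Submodule.mem_sup_left hx, y, hy, rfl⟩
  rwa [T.span_lie] at h

theorem lie_k_m (T : IsGammaTriple Γ s k m) {x y : L} (hx : x ∈ k) (hy : y ∈ m) : ⁅x, y⁆ ∈ m := by
  have h : ⁅x, y⁆ ∈ Submodule.span K
      {w | ∃ x ∈ s.toSubmodule ⊔ k.toSubmodule, ∃ y ∈ m, ⁅x, y⁆ = w} :=
    Submodule.subset_span ⟨x, Submodule.mem_sup_right hx, y, hy, rfl⟩
  rwa [T.span_lie] at h

theorem isCompl_m (T : IsGammaTriple Γ s k m) : IsCompl m (k.toSubmodule ⊔ s.toSubmodule) := by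
  have h := T.levi.2
  rw [← T.sup_eq] at h
  refine ⟨T.disjoint.disjoint_sup_right_of_disjoint_sup_left h.1.symm, codisjoint_iff.2 ?_⟩
  rw [← sup_assoc, sup_comm]
  exact h.sup_eq_top

theorem isCompl_k (T : IsGammaTriple Γ s k m) : IsCompl k.toSubmodule (m ⊔ s.toSubmodule) := by
  have h := T.levi.2
  rw [← T.sup_eq] at h
  refine ⟨T.disjoint.symm.disjoint_sup_right_of_disjoint_sup_left
    (by rw [sup_comm]; exact h.1.symm), codisjoint_iff.2 ?_⟩
  rw [← sup_assoc, sup_comm, sup_comm k.toSubmodule]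
  exact h.sup_eq_top

/-- The projection of `L = s ⊕ k ⊕ m` onto `k`. -/
noncomputable def projK (T : IsGammaTriple Γ s k m) : L →ₗ[K] k :=
  Submodule.projectionOnto k.toSubmodule (m ⊔ s.toSubmodule) T.isCompl_k

/-- The projection of `L = s ⊕ k ⊕ m` onto `m`. -/
noncomputable def projM (T : IsGammaTriple Γ s k m) : L →ₗ[K] m :=
  Submodule.projectionOnto m (k.toSubmodule ⊔ s.toSubmodule) T.isCompl_m

/-- The representation `μ : k → gl(m)`, `μ(x) = (ad x)|_m`. -/
def mu (T : IsGammaTriple Γ s k m) : k →ₗ⁅K⁆ Module.End K m where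
  toFun x := (LieAlgebra.ad K L x).restrict (fun _ hy => T.lie_k_m x.2 hy)
  map_add' x y := by
    ext z
    exact add_lie (x : L) (y : L) (z : L)
  map_smul' c x := by
    ext z
    exact smul_lie c (x : L) (z : L)
  map_lie' {x y} := by
    ext z
    exact lie_lie (x : L) (y : L) (z : L)

@[simp] theorem mu_apply (T : IsGammaTriple Γ s k m) (x : k) (z : m) :
    (T.mu x z : L) = ⁅(x : L), (z : L)⁆ := rfl

end IsGammaTriple

/-- `(Der L)^Γ`: the derivations of `L` commuting with `Γ`. -/
def derInv (Γ : LieSubalgebra K (Module.End K L)) : LieSubalgebra K (LieDerivation K L L) where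
  carrier := {δ | ∀ γ ∈ Γ, ∀ x, δ (γ x) = γ (δ x)}
  add_mem' h₁ h₂ γ hγ x := by simp [h₁ γ hγ, h₂ γ hγ]
  zero_mem' γ hγ x := by simp
  smul_mem' c δ h γ hγ x := by simp [h γ hγ]
  lie_mem' h₁ h₂ γ hγ x := by
    simp only [LieDerivation.commutator_apply, map_sub]
    rw [h₁ γ hγ, h₂ γ hγ, h₁ γ hγ, h₂ γ hγ]

/-- The Lie subalgebra of `L` generated by `m`. -/
def nHat (m : Submodule K L) : LieSubalgebra K L :=
  LieSubalgebra.lieSpan K L (m : Set L)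

/-- `(Der n̂)^Γ`: the derivations of `n̂` commuting with the restriction of `Γ` to `n̂`. -/
def derHatInv (Γ : LieSubalgebra K (Module.End K L)) (m : Submodule K L) :
    LieSubalgebra K (LieDerivation K (nHat m) (nHat m)) where
  carrier := {δ | ∀ γ ∈ Γ, ∀ x y : nHat m, (y : L) = γ x → (δ y : L) = γ (δ x : L)}
  add_mem' h₁ h₂ γ hγ x y hxy := by simp [h₁ γ hγ x y hxy, h₂ γ hγ x y hxy]
  zero_mem' γ hγ x y hxy := by simp
  smul_mem' c δ h γ hγ x y hxy := by simp [h γ hγ x y hxy]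
  lie_mem' {δ₁ δ₂} h₁ h₂ γ hγ x y hxy := by
    rw [LieDerivation.commutator_apply, LieDerivation.commutator_apply, AddSubgroupClass.coe_sub,
      AddSubgroupClass.coe_sub, map_sub]
    rw [h₁ γ hγ (δ₂ x) (δ₂ y) (h₂ γ hγ x y hxy), h₂ γ hγ (δ₁ x) (δ₁ y) (h₁ γ hγ x y hxy)]

/-- The inclusion of `m` in `n̂`. -/
def toHat (x : m) : nHat m := ⟨x, LieSubalgebra.subset_lieSpan x.2⟩

/-- `B = (Der n̂)^Γ|_m`: the endomorphisms of `m` that are restrictions of elements of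
`(Der n̂)^Γ`. -/
def algB (Γ : LieSubalgebra K (Module.End K L)) (m : Submodule K L) :
    LieSubalgebra K (Module.End K m) where
  carrier := {f | ∃ δ ∈ derHatInv Γ m, ∀ x : m, δ (toHat x) = toHat (f x)}
  add_mem' := by
    rintro f g ⟨δ, hδ, h⟩ ⟨ε, hε, h'⟩
    refine ⟨δ + ε, add_mem hδ hε, fun x => ?_⟩
    rw [LieDerivation.add_apply, h, h']
    rfl
  zero_mem' := ⟨0, zero_mem _, fun x => rfl⟩
  smul_mem' := by
    rintro c f ⟨δ, hδ, h⟩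
    refine ⟨c • δ, (derHatInv Γ m).smul_mem c hδ, fun x => ?_⟩
    rw [LieDerivation.smul_apply, h]
    rfl
  lie_mem' := by
    rintro f g ⟨δ, hδ, h⟩ ⟨ε, hε, h'⟩
    refine ⟨⁅δ, ε⁆, (derHatInv Γ m).lie_mem hδ hε, fun x => ?_⟩
    rw [LieDerivation.commutator_apply, h, h', h, h']
    rfl

namespace IsGammaTriple

/-- `N_B(μ(k))`: the normalizer of `μ(k)` in `B`. -/
def normB (T : IsGammaTriple Γ s k m) : LieSubalgebra K (Module.End K m) :=
  algB Γ m ⊓ T.mu.range.normalizer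

end IsGammaTriple

/-- A bilinear map is a Lie bracket: it is alternating and satisfies the Jacobi identity. -/
def IsLieLaw {A : Type*} [AddCommGroup A] [Module K A] (Φ : A →ₗ[K] A →ₗ[K] A) : Prop :=
  (∀ a, Φ a a = 0) ∧ ∀ a b c, Φ a (Φ b c) + Φ b (Φ c a) + Φ c (Φ a b) = 0

/-- A Lie algebra is complete if its center is trivial and all its derivations are inner. -/
def IsComplete (K L : Type*) [Field K] [LieRing L] [LieAlgebra K L] : Prop :=
  LieAlgebra.center K L = ⊥ ∧ ∀ D : LieDerivation K L L, ∃ x : L, D = LieDerivation.ad K L x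

end Triple

end GammaDecomp

/-!
Let `Γ = ad s + (ad k)|_S`. The elements of `Γ` are derivations, because the semisimple part of a
derivation is a derivation; they kill `k`, preserve `s` and `m`, and therefore commute with `ad k`.

Two facts carry the proof. First, the vectors of `L` killed by `Γ` are exactly those of `k`
(`mem_k_iff`). The point is that `Γ` has no nonzero fixed vector in `m`. Complete reducibility gives
`m = Γm ⊕ m^Γ`, and `m = [s + k, m]` then gives `m^Γ = [k, m^Γ]`; as `k` acts on `m^Γ` by nilpotent
maps, Engel's theorem forces `m^Γ = 0` (`fixedPart_m`). In particular `m = Γm`. Derivations commuting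
with `Γ` preserve `k`, and they preserve `m` because derivations preserve the radical.

Second, `Der L = ad s + (Der L)^Γ + ad m` (`exists_ad_add_derInv_add_ad`). Given a derivation `D`,
Whitehead's first lemma for the cocycle `D|_s : s → L` makes `D` vanish on `s` after subtracting an
inner derivation. On the derivations vanishing on `s` the nilpotent algebra `k` acts by
`D ↦ [ad y, D] = -ad (D y)`; the positive Fitting component of this action is inner, and on the null
component the semisimple parts of `ad y` act by zero, so that it commutes with `Γ`. Since `ad k`
commutes with `Γ`, only `ad s` and `ad m` remain.

If the center vanishes, an inner derivation commuting with `Γ` comes from a vector killed by `Γ`,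
hence from `k`, so the sum is direct and completeness becomes a statement about `(Der L)^Γ`. A
derivation commuting with `Γ` vanishes on `s` and is determined on `k` by its restriction to `m`,
as `μ` is injective. Conversely an `f ∈ N` extends by `0` on `s` and by `μ⁻¹ ∘ [f, ·] ∘ μ` on `k`
(`exists_restrictM_eq`): for the Leibniz rule on `m × m` one compares on `k ∩ n̂` with a derivation of
`n̂` extending `f`. Finally `Φ` is the bracket of `Der L`, transported.
-/

/-! ### Whitehead's first lemma -/

namespace GammaDecomp

section Whitehead

open LieAlgebra LieModule Module

variable {K S : Type*} [Field K] [LieRing S] [LieAlgebra K S]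

theorem lieIdeal_eq_bot_of_lie_eq_zero [HasTrivialRadical K S] (I : LieIdeal K S)
    (h : ∀ x ∈ I, ∀ y ∈ I, ⁅x, y⁆ = 0) : I = ⊥ := by
  have : IsLieAbelian I := ⟨fun x y => Subtype.ext (h x x.2 y y.2)⟩
  exact HasTrivialRadical.eq_bot_of_isSolvable I

/-- A semisimple Lie algebra is perfect. -/
theorem lie_top_top_eq_top [CharZero K] [FiniteDimensional K S] [HasTrivialRadical K S] :
    ⁅(⊤ : LieIdeal K S), (⊤ : LieIdeal K S)⁆ = ⊤ := by
  set D : LieIdeal K S := ⁅(⊤ : LieIdeal K S), (⊤ : LieIdeal K S)⁆ with hD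
  have hc := LieIdeal.isCompl_killingCompl D
  -- The Killing complement of the derived ideal is abelian.
  have hJ : LieIdeal.killingCompl K S D = ⊥ := by
    refine lieIdeal_eq_bot_of_lie_eq_zero _ fun x _ y hy => ?_
    have h₁ : ⁅x, y⁆ ∈ D :=
      LieSubmodule.lie_mem_lie (LieSubmodule.mem_top x) (LieSubmodule.mem_top y)
    have h₂ : ⁅x, y⁆ ∈ LieIdeal.killingCompl K S D := LieSubmodule.lie_mem _ hy
    have h₃ := hc.disjoint.le_bot (show ⁅x, y⁆ ∈ D ⊓ LieIdeal.killingCompl K S D from ⟨h₁, h₂⟩)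
    exact (LieSubmodule.mem_bot _).1 h₃
  have := hc.sup_eq_top
  rwa [hJ, sup_bot_eq] at this

/-- The canonical element `∑ bᵢ ⊗ b'ᵢ` of an invariant form, with `b'` dual to `b`, is invariant. -/
theorem sum_lie_dualBasis_eq_zero {M W ι : Type*} [AddCommGroup M] [Module K M] [LieRingModule S M]
    [LieModule K S M] [AddCommGroup W] [Module K W] [Fintype ι] [DecidableEq ι]
    (B : LinearMap.BilinForm K M) (hB : B.Nondegenerate) (hs : B.IsSymm) (hi : B.lieInvariant S)
    (b : Basis ι K M) (Ψ : M →ₗ[K] M →ₗ[K] W) (x : S) :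
    ∑ i, (Ψ ⁅x, b i⁆ (B.dualBasis hB b i) + Ψ (b i) ⁅x, B.dualBasis hB b i⁆) = 0 := by
  have h₁ : ∀ z, z = ∑ i, B z (B.dualBasis hB b i) • b i := fun z => by
    have := (B.dualBasis hB (B.dualBasis hB b)).sum_repr z
    simp only [LinearMap.BilinForm.dualBasis_repr_apply] at this
    simp only [LinearMap.BilinForm.dualBasis_dualBasis hB hs] at this
    exact this.symm
  have h₂ : ∀ z, z = ∑ i, B z (b i) • B.dualBasis hB b i := fun z => by
    have := (B.dualBasis hB b).sum_repr z
    simp only [LinearMap.BilinForm.dualBasis_repr_apply] at this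
    exact this.symm
  have e₁ : ∀ i, Ψ ⁅x, b i⁆ (B.dualBasis hB b i) =
      ∑ j, B ⁅x, b i⁆ (B.dualBasis hB b j) • Ψ (b j) (B.dualBasis hB b i) := fun i => by
    conv_lhs => rw [h₁ ⁅x, b i⁆]
    simp
  have e₂ : ∀ i, Ψ (b i) ⁅x, B.dualBasis hB b i⁆ =
      ∑ j, B ⁅x, B.dualBasis hB b i⁆ (b j) • Ψ (b i) (B.dualBasis hB b j) := fun i => by
    conv_lhs => rw [h₂ ⁅x, B.dualBasis hB b i⁆]
    simp
  simp only [Finset.sum_add_distrib, e₁, e₂]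
  rw [Finset.sum_comm, ← Finset.sum_add_distrib]
  refine Finset.sum_eq_zero fun i _ => ?_
  rw [← Finset.sum_add_distrib]
  refine Finset.sum_eq_zero fun j _ => ?_
  rw [← add_smul, hi x (b j), hs.eq (b j), neg_add_cancel, zero_smul]

variable {V : Type*} [AddCommGroup V] [Module K V] [LieRingModule S V] [LieModule K S V]

/-- The kernel of the trace form of an irreducible module, inside the Killing complement of the
kernel of the representation, vanishes: by Cartan's criterion its derived ideal acts nilpotently,
hence trivially. -/
theorem eq_zero_of_traceForm_eq_zero [CharZero K] [FiniteDimensional K S] [HasTrivialRadical K S]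
    [FiniteDimensional K V] [Nontrivial V]
    (hirr : ∀ N : LieSubmodule K S V, N = ⊥ ∨ N = ⊤) {x : S}
    (hx : x ∈ LieIdeal.killingCompl K S (LieModule.ker K S V))
    (hx' : ∀ y ∈ LieIdeal.killingCompl K S (LieModule.ker K S V), traceForm K S V x y = 0) :
    x = 0 := by
  set J := LieIdeal.killingCompl K S (LieModule.ker K S V) with hJ
  have hc := LieIdeal.isCompl_killingCompl (LieModule.ker K S V)
  let I : LieIdeal K S :=
    { carrier := {x | x ∈ J ∧ ∀ y ∈ J, traceForm K S V x y = 0}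
      add_mem' := fun {a b} ha hb => ⟨add_mem ha.1 hb.1, fun y hy => by
        rw [map_add, LinearMap.add_apply, ha.2 y hy, hb.2 y hy, add_zero]⟩
      zero_mem' := ⟨zero_mem _, fun y _ => by simp⟩
      smul_mem' := fun c a ha => ⟨J.smul_mem c ha.1, fun y hy => by
        rw [map_smul, LinearMap.smul_apply, ha.2 y hy, smul_zero]⟩
      lie_mem := fun {a b} hb => ⟨J.lie_mem hb.1, fun y hy => by
        rw [traceForm_lieInvariant K S V a b y, hb.2 _ (J.lie_mem hy), neg_zero]⟩ }
  have hIJ : ∀ a ∈ I, a ∈ J := fun a ha => ha.1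
  have hI : I = ⊥ := by
    refine lieIdeal_eq_bot_of_lie_eq_zero I fun a ha b hb => ?_
    have htf : traceForm K I V = 0 := by
      ext ⟨a, ha⟩ ⟨b, hb⟩
      exact ha.2 b hb.1
    have hnil := isNilpotent_derivedSeries_of_traceForm_eq_zero htf
    set D : LieIdeal K S := ⁅I, I⁆ with hD
    have hDI : D ≤ I := LieSubmodule.lie_le_left I I
    have hDn : LieModule.IsNilpotent D V := by
      rw [isNilpotent_iff_forall' (R := K)]
      rintro ⟨d, hd⟩
      refine (isNilpotent_iff_forall' (R := K)).1 hnil ⟨⟨d, hDI hd⟩, ?_⟩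
      rw [LieIdeal.derivedSeries_eq_derivedSeriesOfIdeal_comap, LieIdeal.mem_comap]
      exact hd
    let N : LieSubmodule K S V :=
      { carrier := {v | ∀ d ∈ D, ⁅d, v⁆ = 0}
        add_mem' := fun {a b} ha hb d hd => by rw [lie_add, ha d hd, hb d hd, add_zero]
        zero_mem' := fun d _ => lie_zero d
        smul_mem' := fun c a ha d hd => by rw [lie_smul, ha d hd, smul_zero]
        lie_mem := fun {y v} hv d hd => by
          rw [leibniz_lie, hv d hd, lie_zero, add_zero]
          exact hv _ (lie_mem_left K S D d y hd) }
    have hN : N = ⊤ := by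
      refine (hirr N).resolve_left fun h => ?_
      have := nontrivial_max_triv_of_isNilpotent K D V
      obtain ⟨⟨v, hv⟩, hv0⟩ := exists_ne (0 : maxTrivSubmodule K D V)
      refine hv0 (Subtype.ext ?_)
      have hvN : v ∈ N := fun d hd => (mem_maxTrivSubmodule K D V v).1 hv ⟨d, hd⟩
      rw [h] at hvN
      exact (LieSubmodule.mem_bot _).1 hvN
    have h₁ : ⁅a, b⁆ ∈ D := LieSubmodule.lie_mem_lie ha hb
    have h₂ : ⁅a, b⁆ ∈ LieModule.ker K S V := by
      refine (LieModule.mem_ker K S V _).2 fun v => ?_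
      have : v ∈ N := hN ▸ LieSubmodule.mem_top v
      exact this _ h₁
    exact (LieSubmodule.mem_bot _).1 (hc.disjoint.le_bot
      (show ⁅a, b⁆ ∈ LieModule.ker K S V ⊓ J from ⟨h₂, hIJ _ (hDI h₁)⟩))
  have : x ∈ I := ⟨hx, hx'⟩
  rw [hI] at this
  exact (LieSubmodule.mem_bot _).1 this

/-- Whitehead's first lemma for an irreducible module. With dual bases `bᵢ`, `b'ᵢ` for the trace form
on the Killing complement `J` of the kernel of the representation, the Casimir operator
`C = ∑ bᵢ b'ᵢ` has trace `dim J`, hence is invertible unless the action is trivial, and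
`w = ∑ bᵢ f(b'ᵢ)` satisfies `x w = C f(x)`. -/
theorem exists_eq_lie_of_irreducible [CharZero K] [FiniteDimensional K S] [HasTrivialRadical K S]
    [FiniteDimensional K V] [Nontrivial V]
    (hirr : ∀ N : LieSubmodule K S V, N = ⊥ ∨ N = ⊤) (f : S →ₗ[K] V)
    (hf : ∀ x y, f ⁅x, y⁆ = ⁅x, f y⁆ - ⁅y, f x⁆) : ∃ v, ∀ x, f x = ⁅x, v⁆ := by
  classical
  set J := LieIdeal.killingCompl K S (LieModule.ker K S V) with hJ
  have hc := LieIdeal.isCompl_killingCompl (LieModule.ker K S V)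
  let B : LinearMap.BilinForm K J := (traceForm K S V).restrict J.toSubmodule
  have hBapp : ∀ x y : J, B x y = traceForm K S V x y := fun x y => rfl
  have hsym : B.IsSymm := ⟨fun x y => traceForm_comm K S V _ _⟩
  have hinv : B.lieInvariant S := fun x y z => traceForm_lieInvariant K S V x y z
  have hB : B.Nondegenerate := by
    refine hsym.isRefl.nondegenerate_iff_separatingLeft.mpr fun x hx => Subtype.ext ?_
    exact eq_zero_of_traceForm_eq_zero hirr x.2 fun y hy => hx ⟨y, hy⟩
  let b := Module.finBasis K J
  let b' := B.dualBasis hB b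
  let w : V := ∑ i, ⁅(b i : S), f (b' i)⁆
  let C : End K V := ∑ i, toEnd K S V (b i) * toEnd K S V (b' i)
  have hC : ∀ v, C v = ∑ i, ⁅(b i : S), ⁅(b' i : S), v⁆⁆ := fun v => by simp [C]
  have hw : ∀ x : S, ⁅x, w⁆ = C (f x) := fun x => by
    let Ψ : J →ₗ[K] J →ₗ[K] V := LinearMap.mk₂ K (fun y z => ⁅(y : S), f z⁆)
      (fun _ _ _ => by simp) (fun _ _ _ => by simp) (fun _ _ _ => by simp) (fun _ _ _ => by simp)
    have h := sum_lie_dualBasis_eq_zero B hB hsym hinv b Ψ x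
    simp only [Ψ, LinearMap.mk₂_apply, LieSubmodule.coe_bracket, hf] at h
    rw [hC]
    simp only [w, lie_sum]
    rw [← sub_eq_zero, ← Finset.sum_sub_distrib, ← h]
    refine Finset.sum_congr rfl fun i _ => ?_
    rw [leibniz_lie, lie_sub]
    abel
  have hCx : ∀ (x : S) v, ⁅x, C v⁆ = C ⁅x, v⁆ := fun x v => by
    let Ψ : J →ₗ[K] J →ₗ[K] V := LinearMap.mk₂ K (fun y z => ⁅(y : S), ⁅(z : S), v⁆⁆)
      (fun _ _ _ => by simp) (fun _ _ _ => by simp) (fun _ _ _ => by simp) (fun _ _ _ => by simp)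
    have h := sum_lie_dualBasis_eq_zero B hB hsym hinv b Ψ x
    simp only [Ψ, LinearMap.mk₂_apply, LieSubmodule.coe_bracket] at h
    rw [hC, hC]
    simp only [lie_sum]
    rw [← sub_eq_zero, ← Finset.sum_sub_distrib, ← h]
    refine Finset.sum_congr rfl fun i _ => ?_
    rw [leibniz_lie, leibniz_lie x (b' i : S), lie_add]
    abel
  by_cases hJ0 : J = ⊥
  · -- The action is trivial, and a cocycle vanishes on the derived algebra.
    have htriv : ∀ (x : S) (v : V), ⁅x, v⁆ = 0 := fun x => by
      have : LieModule.ker K S V = ⊤ := by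
        have := hc.sup_eq_top
        rwa [← hJ, hJ0, sup_bot_eq] at this
      exact (LieModule.mem_ker K S V x).1 (this ▸ LieSubmodule.mem_top x)
    refine ⟨0, fun x => ?_⟩
    rw [lie_zero]
    have hx : x ∈ ⁅(⊤ : LieIdeal K S), (⊤ : LieIdeal K S)⁆ := by
      rw [lie_top_top_eq_top]
      exact LieSubmodule.mem_top x
    rw [← LieSubmodule.mem_toSubmodule, LieSubmodule.lieIdeal_oper_eq_linear_span'] at hx
    refine Submodule.span_induction (p := fun x _ => f x = 0) ?_ (map_zero f) ?_ ?_ hx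
    · rintro _ ⟨y, -, z, -, rfl⟩
      rw [hf, htriv, htriv, sub_zero]
    · intro y z _ _ hy hz
      rw [map_add, hy, hz, add_zero]
    · intro c y _ hy
      rw [map_smul, hy, smul_zero]
  · have htr : LinearMap.trace K V C = (finrank K J : K) := by
      have : ∀ i, LinearMap.trace K V (toEnd K S V (b i) * toEnd K S V (b' i)) = 1 := fun i => by
        have := LinearMap.BilinForm.apply_dualBasis_right hB hsym b i i
        rw [if_pos rfl, hBapp, traceForm_apply_apply] at this
        exact this
      simp only [C, map_sum, this]
      simp
    have hC0 : C ≠ 0 := by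
      intro h
      rw [h, map_zero] at htr
      have h0 : finrank K J = 0 := by exact_mod_cast htr.symm
      refine hJ0 ?_
      rw [← LieSubmodule.toSubmodule_eq_bot]
      exact Submodule.finrank_eq_zero.1 h0
    let N : LieSubmodule K S V :=
      { LinearMap.ker C with
        lie_mem := fun {x v} hv => by
          have hv' : C v = 0 := hv
          change C ⁅x, v⁆ = 0
          rw [← hCx, hv', lie_zero] }
    have hmem : ∀ v, v ∈ N ↔ C v = 0 := fun v => Iff.rfl
    have hN : N = ⊥ := by
      refine (hirr N).resolve_right fun h => hC0 (LinearMap.ext fun v => ?_)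
      exact (hmem v).1 (h ▸ LieSubmodule.mem_top v)
    have hinj : Function.Injective C := by
      rw [← LinearMap.ker_eq_bot, Submodule.eq_bot_iff]
      intro v hv
      have : v ∈ N := hv
      rw [hN] at this
      exact (LieSubmodule.mem_bot _).1 this
    obtain ⟨v, hv⟩ := (LinearMap.injective_iff_surjective.1 hinj) w
    refine ⟨v, fun x => hinj ?_⟩
    rw [← hw, ← hv, hCx]

/-- **Whitehead's first lemma**: a 1-cocycle of a semisimple Lie algebra with values in a
finite-dimensional module is a coboundary. -/
theorem exists_eq_lie_of_cocycle [CharZero K] [FiniteDimensional K S] [HasTrivialRadical K S]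
    [FiniteDimensional K V] (f : S →ₗ[K] V)
    (hf : ∀ x y, f ⁅x, y⁆ = ⁅x, f y⁆ - ⁅y, f x⁆) : ∃ v, ∀ x, f x = ⁅x, v⁆ := by
  induction hn : finrank K V using Nat.strong_induction_on generalizing V with
  | _ n ih =>
  subst hn
  rcases subsingleton_or_nontrivial V with hV | hV
  · exact ⟨0, fun x => Subsingleton.elim _ _⟩
  by_cases hirr : ∀ N : LieSubmodule K S V, N = ⊥ ∨ N = ⊤
  · exact exists_eq_lie_of_irreducible hirr f hf
  push Not at hirr
  obtain ⟨N, hN₀, hN₁⟩ := hirr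
  have hlt : finrank K N < finrank K V :=
    Submodule.finrank_lt (fun h => hN₁ ((LieSubmodule.toSubmodule_eq_top N).1 h))
  have hpos : 0 < finrank K N :=
    Nat.pos_of_ne_zero fun h =>
      hN₀ ((LieSubmodule.toSubmodule_eq_bot N).1 (Submodule.finrank_eq_zero.1 h))
  have hquot : finrank K (V ⧸ N) < finrank K V := by
    have := Submodule.finrank_quotient_add_finrank N.toSubmodule
    change finrank K (V ⧸ N.toSubmodule) < _
    change _ + finrank K N = _ at this
    omega
  obtain ⟨q, hq⟩ := ih _ hquot ((LieSubmodule.Quotient.mk' N : V →ₗ[K] V ⧸ N) ∘ₗ f)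
    (fun x y => by
      simp only [LinearMap.comp_apply, hf, map_sub]
      rfl) rfl
  obtain ⟨v, rfl⟩ := LieSubmodule.Quotient.surjective_mk' N q
  have hmem : ∀ x, f x - ⁅x, v⁆ ∈ N := fun x => by
    rw [← LieSubmodule.Quotient.mk_eq_zero, map_sub, sub_eq_zero]
    simpa using hq x
  let g : S →ₗ[K] N :=
    (f - (toEnd K S V : S →ₗ[K] End K V).flip v).codRestrict N.toSubmodule fun x => hmem x
  have hg : ∀ x, (g x : V) = f x - ⁅x, v⁆ := fun x => rfl
  obtain ⟨u, hu⟩ := ih _ hlt g (fun x y => Subtype.ext (by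
      simp only [AddSubgroupClass.coe_sub, LieSubmodule.coe_bracket, hg, hf, lie_sub,
        lie_lie]
      abel)) rfl
  refine ⟨v + u, fun x => ?_⟩
  have := congrArg (Subtype.val) (hu x)
  rw [hg, LieSubmodule.coe_bracket] at this
  rw [lie_add, ← this]
  abel

end Whitehead

/-! ### Derivations and the radical -/

section RadicalDerivation

open LieAlgebra

variable {K L : Type*} [Field K] [LieRing L] [LieAlgebra K L]

theorem mem_derivedSeriesOfIdeal_succ_induction {I : LieIdeal K L} {n : ℕ} {p : L → Prop}
    (lie : ∀ x ∈ derivedSeriesOfIdeal K L n I, ∀ y ∈ derivedSeriesOfIdeal K L n I, p ⁅x, y⁆)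
    (zero : p 0) (add : ∀ x y, p x → p y → p (x + y)) (smul : ∀ (c : K) x, p x → p (c • x))
    {x : L} (hx : x ∈ derivedSeriesOfIdeal K L (n + 1) I) : p x := by
  rw [derivedSeriesOfIdeal_succ, ← LieSubmodule.mem_toSubmodule,
    LieSubmodule.lieIdeal_oper_eq_linear_span'] at hx
  refine Submodule.span_induction (p := fun x _ => p x) ?_ zero (fun x y _ _ => add x y)
    (fun c x _ => smul c x) hx
  rintro _ ⟨y, hy, z, hz, rfl⟩
  exact lie y hy z hz

/-- The derivatives of order less than `2 ^ n` of the `n`-th derived ideal of an ideal `I` remain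
in `I`. -/
theorem iterate_mem_of_mem_derivedSeriesOfIdeal (D : LieDerivation K L L) (I : LieIdeal K L)
    (n : ℕ) {a : L} (ha : a ∈ derivedSeriesOfIdeal K L n I) {i : ℕ} (hi : i < 2 ^ n) :
    D^[i] a ∈ I := by
  induction n generalizing a i with
  | zero =>
    obtain rfl : i = 0 := by simpa using hi
    exact ha
  | succ n ih =>
    refine mem_derivedSeriesOfIdeal_succ_induction (p := fun a => D^[i] a ∈ I) ?_ ?_ ?_ ?_ ha
    · intro x hx y hy
      rw [LieDerivation.iterate_apply_lie]
      refine sum_mem fun pq hpq => nsmul_mem ?_ _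
      rw [Finset.HasAntidiagonal.mem_antidiagonal] at hpq
      rcases lt_or_ge pq.1 (2 ^ n) with h | h
      · exact lie_mem_left K L I _ _ (ih hx h)
      · exact lie_mem_right K L I _ _ (ih hy (by rw [pow_succ] at hi; omega))
    · rw [iterate_map_zero]
      exact zero_mem _
    · intro x y hx hy
      rw [iterate_map_add]
      exact add_mem hx hy
    · intro c x hx
      rw [← LieDerivation.coeFn_coe, ← Module.End.pow_apply] at hx ⊢
      rw [map_smul]
      exact I.smul_mem c hx

/-- In characteristic zero, a derivation preserves the radical: if `I` is a solvable ideal, then so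
is `I + D I`, whose `n`-th derived ideal is contained in `I + D ^ (2 ^ n) I⁽ⁿ⁾`. -/
theorem derivation_apply_mem_radical [CharZero K] [FiniteDimensional K L] (D : LieDerivation K L L)
    {a : L} (ha : a ∈ radical K L) : D a ∈ radical K L := by
  set I := radical K L with hI
  let M : LieIdeal K L :=
    { I.toSubmodule ⊔ I.toSubmodule.map (D : L →ₗ[K] L) with
      lie_mem := fun {x z} hz => by
        obtain ⟨b, hb, _, ⟨c, hc, rfl⟩, rfl⟩ := Submodule.mem_sup.1 hz
        rw [lie_add]
        have h : ⁅x, D c⁆ = ⁅c, D x⁆ + D ⁅x, c⁆ := by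
          rw [D.apply_lie_eq_sub]
          abel
        change ⁅x, b⁆ + ⁅x, D c⁆ ∈ I.toSubmodule ⊔ I.toSubmodule.map (D : L →ₗ[K] L)
        rw [h, ← add_assoc]
        exact Submodule.add_mem_sup (add_mem (I.lie_mem hb) (lie_mem_left K L I _ _ hc))
          ⟨⁅x, c⁆, I.lie_mem hc, rfl⟩ }
  have key : ∀ n, ∀ x ∈ derivedSeriesOfIdeal K L n M,
      ∃ b ∈ derivedSeriesOfIdeal K L n I, x - D^[2 ^ n] b ∈ I := by
    intro n
    induction n with
    | zero =>
      intro x hx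
      obtain ⟨b, hb, _, ⟨c, hc, rfl⟩, rfl⟩ := Submodule.mem_sup.1 hx
      refine ⟨c, hc, ?_⟩
      simpa using hb
    | succ n ih =>
      intro x hx
      refine mem_derivedSeriesOfIdeal_succ_induction (p := fun x =>
        ∃ b ∈ derivedSeriesOfIdeal K L (n + 1) I, x - D^[2 ^ (n + 1)] b ∈ I) ?_ ?_ ?_ ?_ hx
      · intro x hx y hy
        obtain ⟨b, hb, hxb⟩ := ih x hx
        obtain ⟨c, hc, hyc⟩ := ih y hy
        -- Modulo `I`, only the middle term of the Leibniz formula for `[b, c]` survives.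
        set N := (2 ^ (n + 1)).choose (2 ^ n) with hN
        have hN0 : (N : K) ≠ 0 :=
          Nat.cast_ne_zero.2 (Nat.choose_pos (Nat.pow_le_pow_right two_pos n.le_succ)).ne'
        have hmid : D^[2 ^ (n + 1)] ⁅b, c⁆ - N • ⁅D^[2 ^ n] b, D^[2 ^ n] c⁆ ∈ I := by
          rw [LieDerivation.iterate_apply_lie,
            ← Finset.add_sum_erase _ _ (show (2 ^ n, 2 ^ n) ∈ Finset.HasAntidiagonal.antidiagonal (2 ^ (n + 1)) by
              rw [Finset.HasAntidiagonal.mem_antidiagonal, pow_succ]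
              omega), add_sub_cancel_left]
          refine sum_mem fun pq hpq => nsmul_mem ?_ _
          rw [Finset.mem_erase, Finset.HasAntidiagonal.mem_antidiagonal, pow_succ] at hpq
          rcases lt_or_ge pq.1 (2 ^ n) with h | h
          · exact lie_mem_left K L I _ _ (iterate_mem_of_mem_derivedSeriesOfIdeal D I n hb h)
          · refine lie_mem_right K L I _ _ (iterate_mem_of_mem_derivedSeriesOfIdeal D I n hc ?_)
            have : pq.1 ≠ 2 ^ n := fun h' => hpq.1 (Prod.ext h' (by omega))
            omega
        have hlie : ⁅x, y⁆ - ⁅D^[2 ^ n] b, D^[2 ^ n] c⁆ ∈ I := by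
          have : ⁅x, y⁆ - ⁅D^[2 ^ n] b, D^[2 ^ n] c⁆ =
              ⁅x - D^[2 ^ n] b, y⁆ + ⁅D^[2 ^ n] b, y - D^[2 ^ n] c⁆ := by
            rw [sub_lie, lie_sub]
            abel
          rw [this]
          exact add_mem (lie_mem_left K L I _ _ hxb) (I.lie_mem hyc)
        refine ⟨(N : K)⁻¹ • ⁅b, c⁆, SMulMemClass.smul_mem _ ?_, ?_⟩
        · rw [derivedSeriesOfIdeal_succ]
          exact LieSubmodule.lie_mem_lie hb hc
        · have hs : D^[2 ^ (n + 1)] ((N : K)⁻¹ • ⁅b, c⁆) =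
              (N : K)⁻¹ • D^[2 ^ (n + 1)] ⁅b, c⁆ := by
            rw [← LieDerivation.coeFn_coe, ← Module.End.pow_apply, map_smul, Module.End.pow_apply]
          have : ⁅x, y⁆ - D^[2 ^ (n + 1)] ((N : K)⁻¹ • ⁅b, c⁆) =
              (⁅x, y⁆ - ⁅D^[2 ^ n] b, D^[2 ^ n] c⁆) - (N : K)⁻¹ •
                (D^[2 ^ (n + 1)] ⁅b, c⁆ - N • ⁅D^[2 ^ n] b, D^[2 ^ n] c⁆) := by
            rw [hs, smul_sub, ← Nat.cast_smul_eq_nsmul K, smul_smul, inv_mul_cancel₀ hN0, one_smul]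
            abel
          rw [this]
          exact sub_mem hlie (I.smul_mem _ hmid)
      · exact ⟨0, zero_mem _, by rw [iterate_map_zero, sub_zero]; exact zero_mem _⟩
      · rintro x y ⟨b, hb, hxb⟩ ⟨c, hc, hyc⟩
        refine ⟨b + c, add_mem hb hc, ?_⟩
        rw [iterate_map_add, add_sub_add_comm]
        exact add_mem hxb hyc
      · rintro t x ⟨b, hb, hxb⟩
        refine ⟨t • b, SMulMemClass.smul_mem _ hb, ?_⟩
        rw [← LieDerivation.coeFn_coe, ← Module.End.pow_apply] at hxb ⊢
        rw [map_smul, ← smul_sub]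
        exact I.smul_mem t hxb
  obtain ⟨n, hn⟩ := IsSolvable.solvable K I
  rw [LieIdeal.derivedSeries_eq_bot_iff] at hn
  have hM : IsSolvable M := by
    refine IsSolvable.mk (R := K) (k := n + n) ?_
    rw [LieIdeal.derivedSeries_eq_bot_iff, derivedSeriesOfIdeal_add, eq_bot_iff, ← hn]
    refine derivedSeriesOfIdeal_mono (fun x hx => ?_) n
    obtain ⟨b, hb, hxb⟩ := key n x hx
    rw [hn] at hb
    rwa [(LieSubmodule.mem_bot b).1 hb, iterate_map_zero, sub_zero] at hxb
  have hle := (LieIdeal.solvable_iff_le_radical K L M).1 hM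
  exact hle (show D a ∈ M from Submodule.mem_sup_right ⟨a, ha, rfl⟩)

end RadicalDerivation

/-! ### Semisimple parts of endomorphisms -/

section JordanParts

open Module Polynomial

variable {K V W : Type*} [Field K] [AddCommGroup V] [Module K V] [AddCommGroup W] [Module K W]

theorem isSemisimple_prodMap [FiniteDimensional K V] [FiniteDimensional K W] {u : End K V}
    {v : End K W} (hu : u.IsSemisimple) (hv : v.IsSemisimple) :
    (LinearMap.prodMapAlgHom K V W (u, v)).IsSemisimple := by
  classical
  -- The product of the minimal polynomials need not be squarefree, but its radical is.
  set p := UniqueFactorizationMonoid.radical (minpoly K u * minpoly K v) with hp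
  have hne : minpoly K u * minpoly K v ≠ 0 :=
    mul_ne_zero (minpoly.ne_zero_of_finite K u) (minpoly.ne_zero_of_finite K v)
  have hpu : minpoly K u ∣ p :=
    (UniqueFactorizationMonoid.dvd_radical_iff hu.minpoly_squarefree.isRadical hne).2
      (dvd_mul_right _ _)
  have hpv : minpoly K v ∣ p :=
    (UniqueFactorizationMonoid.dvd_radical_iff hv.minpoly_squarefree.isRadical hne).2
      (dvd_mul_left _ _)
  refine Module.End.isSemisimple_of_squarefree_aeval_eq_zero
    (UniqueFactorizationMonoid.squarefree_radical (a := minpoly K u * minpoly K v)) ?_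
  rw [aeval_algHom_apply, ← hp]
  have : aeval (u, v) p = (aeval u p, aeval v p) := by
    refine Prod.ext ?_ ?_
    · exact (aeval_algHom_apply (AlgHom.fst K (End K V) (End K W)) (u, v) p).symm
    · exact (aeval_algHom_apply (AlgHom.snd K (End K V) (End K W)) (u, v) p).symm
  rw [this, minpoly.dvd_iff.1 hpu, minpoly.dvd_iff.1 hpv]
  exact map_zero _

namespace IsSemisimplePart

variable {f u : End K V} {g v : End K W}

theorem commute (h : IsSemisimplePart f u) : Commute f u := by
  have := h.2.2.symm.add_left (Commute.refl u)
  rwa [sub_add_cancel] at this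

theorem prodMap [FiniteDimensional K V] [FiniteDimensional K W]
    (h : IsSemisimplePart f u) (h' : IsSemisimplePart g v) :
    IsSemisimplePart (LinearMap.prodMapAlgHom K V W (f, g))
      (LinearMap.prodMapAlgHom K V W (u, v)) := by
  refine ⟨isSemisimple_prodMap h.1 h'.1, ?_, ?_⟩
  · rw [← map_sub]
    refine IsNilpotent.map ?_ _
    obtain ⟨a, ha⟩ := h.2.1
    obtain ⟨b, hb⟩ := h'.2.1
    refine ⟨a + b, ?_⟩
    rw [Prod.mk_sub_mk, Prod.pow_mk, pow_add, ha, zero_mul, pow_add, hb, mul_zero]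
    rfl
  · rw [← map_sub]
    exact (Commute.prod h.2.2 h'.2.2).map _

/-- The semisimple part of `f` kills the generalized null space of `f`. -/
theorem apply_eq_zero (h : IsSemisimplePart f u) {z : V} {n : ℕ} (hz : (f ^ n) z = 0) :
    u z = 0 := by
  have hz' : z ∈ f.genEigenspace 0 n := by
    rw [Module.End.mem_genEigenspace_nat]
    simpa using hz
  have := Module.End.apply_eq_of_mem_of_comm_of_isFinitelySemisimple_of_isNil hz' h.commute
    h.1.isFinitelySemisimple h.2.1
  rwa [zero_smul] at this

/-- An endomorphism is nilpotent on the kernel of its semisimple part. -/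
theorem exists_pow_apply_eq_zero (h : IsSemisimplePart f u) :
    ∃ n : ℕ, ∀ z, u z = 0 → (f ^ n) z = 0 := by
  obtain ⟨n, hn⟩ := h.2.1
  refine ⟨n, fun z hz => ?_⟩
  have : ∀ j : ℕ, (f ^ j) z = ((f - u) ^ j) z := fun j => by
    induction j with
    | zero => rfl
    | succ j ih =>
      have hc : u (((f - u) ^ j) z) = 0 := by
        have := LinearMap.congr_fun (h.2.2.pow_right j).eq z
        rw [Module.End.mul_apply, Module.End.mul_apply, hz, map_zero] at this
        exact this
      rw [pow_succ', pow_succ', Module.End.mul_apply, Module.End.mul_apply, ih,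
        LinearMap.sub_apply, hc, sub_zero]
  rw [this, hn, LinearMap.zero_apply]

variable [CharZero K] [FiniteDimensional K V] [FiniteDimensional K W]

theorem mem_adjoin (h : IsSemisimplePart f u) : u ∈ Algebra.adjoin K {f} := by
  obtain ⟨n, hn, u', hu', hnil, hss, hf⟩ := f.exists_isNilpotent_isSemisimple
  have hc : Commute n u' := Algebra.commute_of_mem_adjoin_singleton_of_commute hu'
    (Algebra.commute_of_mem_adjoin_self hn).symm
  have := (Module.End.isNilpotent_isSemisimple_unique h.2.1 h.1 hnil hss h.2.2.symm hc
    (by rw [← hf]; abel)).2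
  rwa [this]

theorem exists_isSemisimplePart (f : End K V) : ∃ u, IsSemisimplePart f u := by
  obtain ⟨n, hn, u, hu, hnil, hss, hf⟩ := f.exists_isNilpotent_isSemisimple
  have hc : Commute n u := Algebra.commute_of_mem_adjoin_singleton_of_commute hu
    (Algebra.commute_of_mem_adjoin_self hn).symm
  have : f - u = n := by rw [hf]; abel
  exact ⟨u, hss, this ▸ hnil, this ▸ hc.symm⟩

theorem mem_of_stable (h : IsSemisimplePart f u) {P : Submodule K V} (hP : ∀ z ∈ P, f z ∈ P)
    {z : V} (hz : z ∈ P) : u z ∈ P := by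
  obtain ⟨p, rfl⟩ := Algebra.adjoin_mem_exists_aeval K f h.mem_adjoin
  exact p.aeval_apply_smul_mem_of_le_comap hz _ hP

/-- A linear map that intertwines `f` and `g` intertwines their semisimple parts. -/
theorem intertwine (h : IsSemisimplePart f u) (h' : IsSemisimplePart g v) (T : V →ₗ[K] W)
    (hT : ∀ x, T (f x) = g (T x)) (x : V) : T (u x) = v (T x) := by
  -- The map `(x, y) ↦ (0, T x)` commutes with `f × g`, hence with its semisimple part `u × v`.
  let E : End K (V × W) := (LinearMap.inr K V W) ∘ₗ T ∘ₗ (LinearMap.fst K V W)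
  have hE : Commute E (LinearMap.prodMapAlgHom K V W (f, g)) := by
    refine LinearMap.ext fun z => ?_
    simp [E, Module.End.mul_apply, hT]
  have := Algebra.commute_of_mem_adjoin_singleton_of_commute (h.prodMap h').mem_adjoin hE
  have := LinearMap.congr_fun this.eq (x, 0)
  simpa [E, Module.End.mul_apply] using congrArg Prod.snd this

/-- The semisimple part of `ad f` on `gl(V)` is `ad u`. -/
theorem ad (h : IsSemisimplePart f u) :
    IsSemisimplePart (LieAlgebra.ad K (End K V) f) (LieAlgebra.ad K (End K V) u) := by
  refine ⟨LieAlgebra.ad_isSemisimple_of_isSemisimple h.1, ?_, ?_⟩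
  · rw [← map_sub]
    exact LieAlgebra.ad_nilpotent_of_nilpotent h.2.1
  · rw [← map_sub]
    exact LieAlgebra.commute_ad_of_commute h.2.2

/-- The semisimple part of a derivation is a derivation. -/
theorem map_lie {L : Type*} [LieRing L] [LieAlgebra K L] [FiniteDimensional K L]
    {f u : End K L} (h : IsSemisimplePart f u) (hf : ∀ x y, f ⁅x, y⁆ = ⁅f x, y⁆ + ⁅x, f y⁆)
    (x y : L) : u ⁅x, y⁆ = ⁅u x, y⁆ + ⁅x, u y⁆ := by
  -- A map `f` is a derivation if and only if `ad : L → gl(L)` intertwines `f` and `ad f`.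
  have := h.intertwine h.ad (LieAlgebra.ad K L : L →ₗ[K] End K L) (fun x => by
    refine LinearMap.ext fun y => ?_
    simp [Ring.lie_def, Module.End.mul_apply, hf]) x
  have := LinearMap.congr_fun this y
  simp only [LieHom.coe_toLinearMap, LieAlgebra.ad_apply, Ring.lie_def, LinearMap.sub_apply,
    Module.End.mul_apply] at this
  rw [this]
  abel

end IsSemisimplePart

end JordanParts

/-! ### Fixed vectors of `Γ` -/

section TripleFacts

open Module

variable {K L : Type*} [Field K] [LieRing L] [LieAlgebra K L]

/-- A module over a Lie algebra acting by nilpotent maps vanishes if it is spanned by brackets: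
this is Nakayama's lemma, deduced from Engel's theorem. -/
theorem eq_bot_of_le_span_lie [FiniteDimensional K L] (k : LieSubalgebra K L) (P : Submodule K L)
    (hP : ∀ y ∈ k, ∀ z ∈ P, ⁅y, z⁆ ∈ P)
    (hnil : ∀ y ∈ k, ∃ n : ℕ, ∀ z ∈ P, ((LieAlgebra.ad K L y) ^ n) z = 0)
    (hspan : P ≤ Submodule.span K {w | ∃ y ∈ k, ∃ z ∈ P, ⁅y, z⁆ = w}) : P = ⊥ := by
  let M : LieSubmodule K k L := { P with lie_mem := fun {y z} hz => hP y y.2 z hz }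
  have hMn : LieModule.IsNilpotent k M := by
    rw [LieModule.isNilpotent_iff_forall' (R := K)]
    intro y
    obtain ⟨n, hn⟩ := hnil y y.2
    refine ⟨n, LinearMap.ext fun z => Subtype.ext ?_⟩
    have : ∀ (j : ℕ) (z : M),
        (((LieModule.toEnd K k M y) ^ j) z : L) = ((LieAlgebra.ad K L y) ^ j) z := fun j => by
      induction j with
      | zero => exact fun z => rfl
      | succ j ih => exact fun z => by rw [pow_succ, pow_succ, Module.End.mul_apply, ih]; rfl
    rw [this, hn _ z.2]
    rfl
  have htop : ⁅(⊤ : LieIdeal K k), M⁆ = M := by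
    refine le_antisymm (LieSubmodule.lie_le_right _ _) fun z hz => ?_
    have := hspan hz
    rw [← LieSubmodule.mem_toSubmodule, LieSubmodule.lieIdeal_oper_eq_linear_span']
    refine Submodule.span_mono ?_ this
    rintro _ ⟨y, hy, z, hz, rfl⟩
    exact ⟨⟨y, hy⟩, LieSubmodule.mem_top _, z, hz, rfl⟩
  have hlcs : ∀ n, M.lcs n = M := fun n => by
    induction n with
    | zero => exact LieSubmodule.lcs_zero M
    | succ n ih => rw [LieSubmodule.lcs_succ, ih, htop]
  obtain ⟨n, hn⟩ := (LieModule.isNilpotent_iff K k M).1 hMn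
  have : M.lcs n = ⊥ := by
    rw [LieSubmodule.lowerCentralSeries_eq_lcs_comap, LieSubmodule.comap_incl_eq_bot] at hn
    have := LieSubmodule.lcs_le_self n M
    rwa [inf_eq_right.2 this] at hn
  rw [hlcs] at this
  exact congrArg LieSubmodule.toSubmodule this

/-- The subspace of `P` of vectors killed by `Γ`. -/
def fixedPart (Γ : LieSubalgebra K (End K L)) (P : Submodule K L) : Submodule K L where
  carrier := {z | z ∈ P ∧ ∀ γ ∈ Γ, γ z = 0}
  add_mem' ha hb := ⟨add_mem ha.1 hb.1, fun γ hγ => by rw [map_add, ha.2 γ hγ, hb.2 γ hγ, add_zero]⟩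
  zero_mem' := ⟨zero_mem _, fun γ _ => map_zero γ⟩
  smul_mem' c _ ha := ⟨P.smul_mem c ha.1, fun γ hγ => by rw [map_smul, ha.2 γ hγ, smul_zero]⟩

/-- The subspace `Γ P` spanned by the images of vectors of `P` under `Γ`. -/
def movedPart (Γ : LieSubalgebra K (End K L)) (P : Submodule K L) : Submodule K L :=
  Submodule.span K {w | ∃ γ ∈ Γ, ∃ z ∈ P, γ z = w}

theorem apply_mem_movedPart {Γ : LieSubalgebra K (End K L)} {P : Submodule K L} {γ : End K L}
    (hγ : γ ∈ Γ) {z : L} (hz : z ∈ P) : γ z ∈ movedPart Γ P :=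
  Submodule.subset_span ⟨γ, hγ, z, hz, rfl⟩

theorem movedPart_le {Γ : LieSubalgebra K (End K L)} {P Q : Submodule K L}
    (h : ∀ γ ∈ Γ, ∀ z ∈ P, γ z ∈ Q) : movedPart Γ P ≤ Q := by
  refine Submodule.span_le.2 ?_
  rintro _ ⟨γ, hγ, z, hz, rfl⟩
  exact h γ hγ z hz

namespace IsCompletelyReducible

variable {Γ : LieSubalgebra K (End K L)} {P : Submodule K L}

theorem le_movedPart_sup_fixedPart (hΓ : IsCompletelyReducible Γ)
    (hP : ∀ γ ∈ Γ, ∀ z ∈ P, γ z ∈ P) : P ≤ movedPart Γ P ⊔ fixedPart Γ P := by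
  have hle : movedPart Γ P ≤ P := movedPart_le hP
  obtain ⟨C, hC, hcompl⟩ := hΓ (movedPart Γ P) fun γ hγ w hw => apply_mem_movedPart hγ (hle hw)
  intro z hz
  obtain ⟨a, ha, c, hc, rfl⟩ := Submodule.mem_sup.1
    (show z ∈ movedPart Γ P ⊔ C by rw [hcompl.sup_eq_top]; trivial)
  have hcP : c ∈ P := by simpa using sub_mem hz (hle ha)
  refine Submodule.add_mem_sup ha ⟨hcP, fun γ hγ => ?_⟩
  exact (Submodule.mem_bot K).1 (hcompl.disjoint.le_bot
    ⟨apply_mem_movedPart hγ hcP, hC γ hγ c hc⟩)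

theorem disjoint_movedPart_fixedPart (hΓ : IsCompletelyReducible Γ) :
    Disjoint (movedPart Γ P) (fixedPart Γ P) := by
  obtain ⟨C, hC, hcompl⟩ := hΓ (fixedPart Γ P) fun γ hγ w hw => by
    rw [hw.2 γ hγ]
    exact zero_mem _
  refine (hcompl.symm.disjoint.mono_left (movedPart_le fun γ hγ z hz => ?_))
  obtain ⟨a, ha, c, hc, rfl⟩ := Submodule.mem_sup.1
    (show z ∈ fixedPart Γ P ⊔ C by rw [hcompl.sup_eq_top]; trivial)
  rw [map_add, ha.2 γ hγ, zero_add]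
  exact hC γ hγ c hc

end IsCompletelyReducible

namespace IsGammaTriple

variable {Γ : LieSubalgebra K (End K L)} {s k : LieSubalgebra K L} {m : Submodule K L}

theorem completelyReducible (T : IsGammaTriple Γ s k m) : IsCompletelyReducible Γ :=
  T.maximal.prop.2

theorem exists_add_add (T : IsGammaTriple Γ s k m) (w : L) :
    ∃ x ∈ s, ∃ y ∈ k, ∃ z ∈ m, w = x + y + z := by
  have h : w ∈ m ⊔ (k.toSubmodule ⊔ s.toSubmodule) := by
    rw [T.isCompl_m.sup_eq_top]
    trivial
  obtain ⟨z, hz, v, hv, rfl⟩ := Submodule.mem_sup.1 h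
  obtain ⟨y, hy, x, hx, rfl⟩ := Submodule.mem_sup.1 hv
  exact ⟨x, hx, y, hy, z, hz, by abel⟩

theorem eq_zero_of_add_add_eq_zero (T : IsGammaTriple Γ s k m) {x y z : L} (hx : x ∈ s)
    (hy : y ∈ k) (hz : z ∈ m) (h : x + y + z = 0) : x = 0 ∧ y = 0 ∧ z = 0 := by
  have hz0 : z = 0 := by
    refine (Submodule.mem_bot K).1 (T.isCompl_m.disjoint.le_bot ⟨hz, ?_⟩)
    rw [eq_neg_of_add_eq_zero_right h]
    exact neg_mem (add_mem (Submodule.mem_sup_right hx) (Submodule.mem_sup_left hy))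
  have hy0 : y = 0 := by
    refine (Submodule.mem_bot K).1 (T.isCompl_k.disjoint.le_bot ⟨hy, ?_⟩)
    rw [hz0, add_zero] at h
    rw [eq_neg_of_add_eq_zero_right h]
    exact neg_mem (Submodule.mem_sup_right hx)
  rw [hz0, hy0, add_zero, add_zero] at h
  exact ⟨h, hy0, hz0⟩

theorem exists_lie_eq_add (T : IsGammaTriple Γ s k m) (z : L) {w : L} (hw : w ∈ m) :
    ∃ y ∈ k, ∃ v ∈ m, ⁅z, w⁆ = y + v := by
  have h : ⁅z, w⁆ ∈ m ⊔ k.toSubmodule := by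
    have hw' : w ∈ m ⊔ k.toSubmodule := Submodule.mem_sup_left hw
    rw [T.sup_eq] at hw' ⊢
    exact (LieAlgebra.radical K L).lie_mem hw'
  obtain ⟨v, hv, y, hy, h⟩ := Submodule.mem_sup.1 h
  exact ⟨y, hy, v, hv, by rw [← h, add_comm]⟩

theorem projK_add_add (T : IsGammaTriple Γ s k m) {x y z : L} (hx : x ∈ s) (hy : y ∈ k)
    (hz : z ∈ m) : T.projK (x + y + z) = ⟨y, hy⟩ := by
  have h₁ : T.projK y = ⟨y, hy⟩ := Submodule.projectionOnto_apply_left T.isCompl_k ⟨y, hy⟩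
  have h₂ : T.projK (x + z) = 0 := (Submodule.projectionOnto_apply_eq_zero_iff T.isCompl_k).2
    (add_mem (Submodule.mem_sup_right hx) (Submodule.mem_sup_left hz))
  rw [show x + y + z = y + (x + z) by abel, map_add, h₁, h₂, add_zero]

theorem projM_add_add (T : IsGammaTriple Γ s k m) {x y z : L} (hx : x ∈ s) (hy : y ∈ k)
    (hz : z ∈ m) : T.projM (x + y + z) = ⟨z, hz⟩ := by
  have h₁ : T.projM z = ⟨z, hz⟩ := Submodule.projectionOnto_apply_left T.isCompl_m ⟨z, hz⟩
  have h₂ : T.projM (x + y) = 0 := (Submodule.projectionOnto_apply_eq_zero_iff T.isCompl_m).2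
    (add_mem (Submodule.mem_sup_right hx) (Submodule.mem_sup_left hy))
  rw [map_add, h₁, h₂, zero_add]

theorem ad_pow_apply_eq_zero (T : IsGammaTriple Γ s k m) {y : L} (hy : y ∈ k) :
    ∃ n : ℕ, ∀ z ∈ k, ((LieAlgebra.ad K L y) ^ n) z = 0 := by
  have := T.nilpotent
  obtain ⟨n, hn⟩ := LieModule.isNilpotent_toEnd_of_isNilpotent K k k ⟨y, hy⟩
  refine ⟨n, fun z hz => ?_⟩
  have : ∀ (j : ℕ) (z : k),
      (((LieModule.toEnd K k k ⟨y, hy⟩) ^ j) z : L) = ((LieAlgebra.ad K L y) ^ j) z := fun j => by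
    induction j with
    | zero => exact fun z => rfl
    | succ j ih => exact fun z => by rw [pow_succ, pow_succ, Module.End.mul_apply, ih]; rfl
  rw [← this n ⟨z, hz⟩, hn]
  rfl

theorem ad_mem (T : IsGammaTriple Γ s k m) {x : L} (hx : x ∈ s) : LieAlgebra.ad K L x ∈ Γ := by
  refine (T.mem_iff _).2 ⟨x, hx, 0, zero_mem _, 0, ⟨?_, ?_, ?_⟩, by rw [add_zero]⟩
  · exact Module.End.isSemisimple_zero
  · rw [map_zero, sub_zero]
    exact IsNilpotent.zero
  · exact Commute.zero_left _

theorem semisimplePart_mem (T : IsGammaTriple Γ s k m) {y : L} (hy : y ∈ k) {u : End K L}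
    (hu : IsSemisimplePart (LieAlgebra.ad K L y) u) : u ∈ Γ :=
  (T.mem_iff _).2 ⟨0, zero_mem _, y, hy, u, hu, by rw [map_zero, zero_add]⟩

theorem apply_mem_s (T : IsGammaTriple Γ s k m) {γ : End K L} (hγ : γ ∈ Γ) {z : L} (hz : z ∈ s) :
    γ z ∈ s := by
  obtain ⟨x, hx, y, hy, u, hu, rfl⟩ := (T.mem_iff γ).1 hγ
  have : u z = 0 := hu.apply_eq_zero (n := 1) (by
    rw [pow_one, LieAlgebra.ad_apply, ← lie_skew, T.lie_s_k z hz y hy, neg_zero])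
  rw [LinearMap.add_apply, this, add_zero]
  exact s.lie_mem hx hz

/-- `Γ` kills `k`: the maps `ad y`, `y ∈ k`, are nilpotent on the nilpotent algebra `k`. -/
theorem apply_k (T : IsGammaTriple Γ s k m) {γ : End K L} (hγ : γ ∈ Γ) {z : L} (hz : z ∈ k) :
    γ z = 0 := by
  obtain ⟨x, hx, y, hy, u, hu, rfl⟩ := (T.mem_iff γ).1 hγ
  obtain ⟨n, hn⟩ := T.ad_pow_apply_eq_zero hy
  rw [LinearMap.add_apply, hu.apply_eq_zero (hn z hz), LieAlgebra.ad_apply, T.lie_s_k x hx z hz,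
    add_zero]

theorem eq_zero_of_lie_s (T : IsGammaTriple Γ s k m) {x : L} (hx : x ∈ s)
    (h : ∀ y ∈ s, ⁅y, x⁆ = 0) : x = 0 := by
  have := T.levi.1
  have hc : (⟨x, hx⟩ : s) ∈ LieAlgebra.center K s := fun y => Subtype.ext (h y y.2)
  have hle := LieAlgebra.center_le_radical K s hc
  rw [LieAlgebra.HasTrivialRadical.radical_eq_bot] at hle
  exact congrArg Subtype.val ((LieSubmodule.mem_bot _).1 hle)

section Action

variable [CharZero K] [FiniteDimensional K L]

/-- The elements of `Γ` are derivations. -/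
theorem apply_lie (T : IsGammaTriple Γ s k m) {γ : End K L} (hγ : γ ∈ Γ) (v w : L) :
    γ ⁅v, w⁆ = ⁅γ v, w⁆ + ⁅v, γ w⁆ := by
  obtain ⟨x, -, y, -, u, hu, rfl⟩ := (T.mem_iff γ).1 hγ
  have := hu.map_lie (fun v w => leibniz_lie y v w) v w
  rw [LinearMap.add_apply, LinearMap.add_apply, LinearMap.add_apply, this, add_lie, lie_add]
  simp only [LieAlgebra.ad_apply]
  rw [leibniz_lie x v w]
  abel

theorem apply_mem_m (T : IsGammaTriple Γ s k m) {γ : End K L} (hγ : γ ∈ Γ) {z : L} (hz : z ∈ m) :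
    γ z ∈ m := by
  obtain ⟨x, hx, y, hy, u, hu, rfl⟩ := (T.mem_iff γ).1 hγ
  exact add_mem (T.lie_s_m hx hz) (hu.mem_of_stable (fun w hw => T.lie_k_m hy hw) hz)

/-- `Γ` commutes with `ad k`. -/
theorem apply_lie_k (T : IsGammaTriple Γ s k m) {γ : End K L} (hγ : γ ∈ Γ) {y : L} (hy : y ∈ k)
    (w : L) : γ ⁅y, w⁆ = ⁅y, γ w⁆ := by
  rw [T.apply_lie hγ, T.apply_k hγ hy, zero_lie, zero_add]

theorem lie_movedPart (T : IsGammaTriple Γ s k m) {y : L} (hy : y ∈ k) {z : L}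
    (hz : z ∈ movedPart Γ m) : ⁅y, z⁆ ∈ movedPart Γ m := by
  refine Submodule.span_induction (p := fun z _ => ⁅y, z⁆ ∈ movedPart Γ m) ?_ ?_ ?_ ?_ hz
  · rintro _ ⟨γ, hγ, w, hw, rfl⟩
    rw [← T.apply_lie_k hγ hy]
    exact apply_mem_movedPart hγ (T.lie_k_m hy hw)
  · rw [lie_zero]
    exact zero_mem _
  · intro a b _ _ ha hb
    rw [lie_add]
    exact add_mem ha hb
  · intro c a _ ha
    rw [lie_smul]
    exact Submodule.smul_mem _ c ha

/-- No nonzero vector of `m` is killed by `Γ`. Such vectors form a module on which `k` acts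
nilpotently, and `m = [s + k, m]` forces it to be spanned by brackets with `k`. -/
theorem fixedPart_m (T : IsGammaTriple Γ s k m) : fixedPart Γ m = ⊥ := by
  have hfix : ∀ y ∈ k, ∀ z ∈ fixedPart Γ m, ⁅y, z⁆ ∈ fixedPart Γ m := fun y hy z hz =>
    ⟨T.lie_k_m hy hz.1, fun γ hγ => by rw [T.apply_lie_k hγ hy, hz.2 γ hγ, lie_zero]⟩
  refine eq_bot_of_le_span_lie k _ hfix (fun y hy => ?_) ?_
  · obtain ⟨u, hu⟩ := IsSemisimplePart.exists_isSemisimplePart (LieAlgebra.ad K L y)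
    obtain ⟨n, hn⟩ := hu.exists_pow_apply_eq_zero
    exact ⟨n, fun z hz => hn z (hz.2 u (T.semisimplePart_mem hy hu))⟩
  · set Q := Submodule.span K {w | ∃ y ∈ k, ∃ z ∈ fixedPart Γ m, ⁅y, z⁆ = w} with hQ
    have hQle : Q ≤ fixedPart Γ m := by
      refine Submodule.span_le.2 ?_
      rintro _ ⟨y, hy, z, hz, rfl⟩
      exact hfix y hy z hz
    have hm : m ≤ movedPart Γ m ⊔ Q := by
      conv_lhs => rw [← T.span_lie]
      refine Submodule.span_le.2 ?_
      rintro _ ⟨v, hv, z, hz, rfl⟩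
      obtain ⟨x, hx, y, hy, rfl⟩ := Submodule.mem_sup.1 hv
      obtain ⟨a, ha, b, hb, hab⟩ := Submodule.mem_sup.1
        (T.completelyReducible.le_movedPart_sup_fixedPart (fun γ hγ z hz => T.apply_mem_m hγ hz) hz)
      have h₁ : ⁅x, z⁆ ∈ movedPart Γ m := apply_mem_movedPart (T.ad_mem hx) hz
      rw [add_lie, ← hab, lie_add y, ← add_assoc, hab]
      exact Submodule.add_mem_sup (add_mem h₁ (T.lie_movedPart hy ha))
        (Submodule.subset_span ⟨y, hy, b, hb, rfl⟩)
    intro z hz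
    obtain ⟨a, ha, b, hb, hab⟩ := Submodule.mem_sup.1 (hm hz.1)
    have ha' : a ∈ fixedPart Γ m := by
      rw [eq_sub_of_add_eq hab]
      exact sub_mem hz (hQle hb)
    have : a = 0 := (Submodule.mem_bot K).1
      (T.completelyReducible.disjoint_movedPart_fixedPart.le_bot ⟨ha, ha'⟩)
    rw [← hab, this, zero_add]
    exact hb

theorem m_le_movedPart (T : IsGammaTriple Γ s k m) : m ≤ movedPart Γ m := by
  have := T.completelyReducible.le_movedPart_sup_fixedPart (P := m)
    fun γ hγ z hz => T.apply_mem_m hγ hz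
  rwa [T.fixedPart_m, sup_bot_eq] at this

/-- The vectors killed by `Γ` are those of `k`. -/
theorem mem_k_iff (T : IsGammaTriple Γ s k m) {w : L} : w ∈ k ↔ ∀ γ ∈ Γ, γ w = 0 := by
  refine ⟨fun hw γ hγ => T.apply_k hγ hw, fun h => ?_⟩
  obtain ⟨x, hx, y, hy, z, hz, rfl⟩ := T.exists_add_add w
  have hxz : ∀ γ ∈ Γ, γ x = 0 ∧ γ z = 0 := fun γ hγ => by
    have := h γ hγ
    rw [map_add, map_add, T.apply_k hγ hy] at this
    obtain ⟨h₁, -, h₂⟩ := T.eq_zero_of_add_add_eq_zero (T.apply_mem_s hγ hx) k.zero_mem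
      (T.apply_mem_m hγ hz) this
    exact ⟨h₁, h₂⟩
  have hx0 : x = 0 := T.eq_zero_of_lie_s hx fun v hv => (hxz _ (T.ad_mem hv)).1
  have hz0 : z = 0 := by
    have : z ∈ fixedPart Γ m := ⟨hz, fun γ hγ => (hxz γ hγ).2⟩
    rw [T.fixedPart_m] at this
    exact (Submodule.mem_bot K).1 this
  rwa [hx0, hz0, zero_add, add_zero]

/-- A linear map that kills `[s, s]` kills `s`, because `s` is perfect. -/
theorem eq_zero_of_map_lie (T : IsGammaTriple Γ s k m) {V : Type*} [AddCommGroup V] [Module K V]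
    (f : L →ₗ[K] V) (hf : ∀ x ∈ s, ∀ y ∈ s, f ⁅x, y⁆ = 0) {x : L} (hx : x ∈ s) : f x = 0 := by
  have := T.levi.1
  have hx' : (⟨x, hx⟩ : s) ∈ ⁅(⊤ : LieIdeal K s), (⊤ : LieIdeal K s)⁆ := by
    rw [lie_top_top_eq_top]
    exact LieSubmodule.mem_top _
  rw [← LieSubmodule.mem_toSubmodule, LieSubmodule.lieIdeal_oper_eq_linear_span'] at hx'
  refine Submodule.span_induction (p := fun (x : s) _ => f x = 0) ?_ (map_zero f) ?_ ?_ hx'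
  · rintro _ ⟨y, -, z, -, rfl⟩
    exact hf y y.2 z z.2
  · intro y z _ _ hy hz
    change f ((y : L) + z) = 0
    rw [map_add, hy, hz, add_zero]
  · intro c y _ hy
    change f (c • (y : L)) = 0
    rw [map_smul, hy, smul_zero]

end Action

end IsGammaTriple

end TripleFacts

/-! ### Derivations commuting with `Γ` -/

namespace IsGammaTriple

section Derivations

open Module

variable {K L : Type*} [Field K] [LieRing L] [LieAlgebra K L]
variable {Γ : LieSubalgebra K (End K L)} {s k : LieSubalgebra K L} {m : Submodule K L}

/-- The action of `y` on derivations is `D ↦ [ad y, D]`. -/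
theorem toEnd_pow_apply (y : L) (n : ℕ) (D : LieDerivation K L L) :
    ((((LieModule.toEnd K L (LieDerivation K L L) y) ^ n) D : LieDerivation K L L) : End K L) =
      ((LieAlgebra.ad K (End K L) (LieAlgebra.ad K L y)) ^ n) (D : End K L) := by
  induction n generalizing D with
  | zero => rfl
  | succ n ih =>
    rw [pow_succ, pow_succ, Module.End.mul_apply, Module.End.mul_apply, ih]
    congr 1
    refine LinearMap.ext fun x => ?_
    simp [Ring.lie_def, Module.End.mul_apply]

/-- An endomorphism of `L` that satisfies the Leibniz rule on `s`, `k` and `m` and between them is a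
derivation. -/
theorem leibniz_of_cases (T : IsGammaTriple Γ s k m) (D : End K L)
    (hss : ∀ a ∈ s, ∀ b ∈ s, D ⁅a, b⁆ = ⁅a, D b⁆ - ⁅b, D a⁆)
    (hsk : ∀ a ∈ s, ∀ b ∈ k, D ⁅a, b⁆ = ⁅a, D b⁆ - ⁅b, D a⁆)
    (hsm : ∀ a ∈ s, ∀ b ∈ m, D ⁅a, b⁆ = ⁅a, D b⁆ - ⁅b, D a⁆)
    (hkk : ∀ a ∈ k, ∀ b ∈ k, D ⁅a, b⁆ = ⁅a, D b⁆ - ⁅b, D a⁆)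
    (hkm : ∀ a ∈ k, ∀ b ∈ m, D ⁅a, b⁆ = ⁅a, D b⁆ - ⁅b, D a⁆)
    (hmm : ∀ a ∈ m, ∀ b ∈ m, D ⁅a, b⁆ = ⁅a, D b⁆ - ⁅b, D a⁆) (a b : L) :
    D ⁅a, b⁆ = ⁅a, D b⁆ - ⁅b, D a⁆ := by
  have hswap : ∀ a b, D ⁅a, b⁆ = ⁅a, D b⁆ - ⁅b, D a⁆ → D ⁅b, a⁆ = ⁅b, D a⁆ - ⁅a, D b⁆ :=
    fun a b h => by rw [← lie_skew, map_neg, h, neg_sub]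
  have hadd : ∀ a b c, D ⁅a, b⁆ = ⁅a, D b⁆ - ⁅b, D a⁆ → D ⁅a, c⁆ = ⁅a, D c⁆ - ⁅c, D a⁆ →
      D ⁅a, b + c⁆ = ⁅a, D (b + c)⁆ - ⁅b + c, D a⁆ := fun a b c h₁ h₂ => by
    rw [lie_add, map_add, h₁, h₂, map_add, lie_add, add_lie]
    abel
  obtain ⟨x, hx, y, hy, z, hz, rfl⟩ := T.exists_add_add a
  obtain ⟨x', hx', y', hy', z', hz', rfl⟩ := T.exists_add_add b
  refine hadd _ _ _ (hadd _ _ _ ?_ ?_) ?_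
  · exact hswap _ _ (hadd _ _ _ (hadd _ _ _ (hss _ hx' _ hx) (hsk _ hx' _ hy)) (hsm _ hx' _ hz))
  · exact hswap _ _ (hadd _ _ _ (hadd _ _ _ (hswap _ _ (hsk _ hx _ hy')) (hkk _ hy' _ hy))
      (hkm _ hy' _ hz))
  · exact hswap _ _ (hadd _ _ _ (hadd _ _ _ (hswap _ _ (hsm _ hx _ hz'))
      (hswap _ _ (hkm _ hy _ hz'))) (hmm _ hz' _ hz))

variable [CharZero K] [FiniteDimensional K L]

theorem ad_mem_derInv (T : IsGammaTriple Γ s k m) {y : L} (hy : y ∈ k) :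
    LieDerivation.ad K L y ∈ derInv Γ := fun γ hγ w => by
  simpa using (T.apply_lie_k hγ hy w).symm

/-- If the center is trivial and `ad w` commutes with `Γ`, then `Γ` kills `w`: for `γ ∈ Γ` one has
`ad (γ w) = [γ, ad w] = 0`. -/
theorem mem_k_of_ad_mem_derInv (T : IsGammaTriple Γ s k m) (hZ : LieAlgebra.center K L = ⊥) {w : L}
    (hw : LieDerivation.ad K L w ∈ derInv Γ) : w ∈ k := by
  refine T.mem_k_iff.2 fun γ hγ => ?_
  have hc : γ w ∈ LieAlgebra.center K L := fun v => by
    have h := hw γ hγ v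
    simp only [LieDerivation.ad_apply_apply] at h
    rw [T.apply_lie hγ] at h
    have h' : ⁅γ w, v⁆ = 0 := add_eq_right.1 h.symm
    rw [← lie_skew, h', neg_zero]
  rw [hZ] at hc
  exact (LieSubmodule.mem_bot _).1 hc

/-- A derivation that vanishes on `s`, and on which `k` acts nilpotently, commutes with `Γ`. -/
theorem mem_derInv_of_nilpotent (T : IsGammaTriple Γ s k m) {D : LieDerivation K L L}
    (hs : ∀ x ∈ s, D x = 0)
    (hk : ∀ y ∈ k, ∃ n : ℕ, ((LieModule.toEnd K L (LieDerivation K L L) y) ^ n) D = 0) :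
    D ∈ derInv Γ := by
  intro γ hγ v
  obtain ⟨x, hx, y, hy, u, hu, rfl⟩ := (T.mem_iff γ).1 hγ
  obtain ⟨n, hn⟩ := hk y hy
  have h₁ : LieAlgebra.ad K (End K L) u (D : End K L) = 0 := hu.ad.apply_eq_zero (n := n) (by
    rw [← toEnd_pow_apply, hn]
    rfl)
  have h₂ : u (D v) - D (u v) = 0 := LinearMap.congr_fun h₁ v
  rw [LinearMap.add_apply, LinearMap.add_apply, map_add, LieAlgebra.ad_apply, LieAlgebra.ad_apply,
    LieDerivation.apply_lie_eq_sub, hs x hx, lie_zero, sub_zero, sub_eq_zero.1 h₂]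

/-- Every derivation is inner modulo the derivations commuting with `Γ`. Whitehead's lemma makes it
vanish on `s`, and the positive Fitting component of the action of `k` on the derivations vanishing
on `s` is inner. -/
theorem exists_derInv_add_ad (T : IsGammaTriple Γ s k m) (D : LieDerivation K L L) :
    ∃ δ ∈ derInv Γ, ∃ w, D = δ + LieDerivation.ad K L w := by
  have hr := T.levi.1
  have hn := T.nilpotent
  obtain ⟨w, hw⟩ := exists_eq_lie_of_cocycle (K := K) (S := s) (V := L)
    ((D : L →ₗ[K] L) ∘ₗ s.toSubmodule.subtype) (fun x y => D.apply_lie_eq_sub x y)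
  let N : LieSubmodule K k (LieDerivation K L L) :=
    { carrier := {E | ∀ x ∈ s, E x = 0}
      add_mem' := fun {a b} ha hb x hx => by rw [LieDerivation.add_apply, ha x hx, hb x hx, add_zero]
      zero_mem' := fun x _ => rfl
      smul_mem' := fun c a ha x hx => by rw [LieDerivation.smul_apply, ha x hx, smul_zero]
      lie_mem := fun {y E} hE x hx => by
        have hE' : ∀ x ∈ s, E x = 0 := hE
        change ⁅x, E (y : L)⁆ = 0
        have := E.apply_lie_eq_sub x y
        rw [T.lie_s_k x hx y y.2, map_zero, hE' x hx, lie_zero, sub_zero] at this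
        exact this.symm }
  have hN : D + LieDerivation.ad K L w ∈ N := fun x hx => by
    have : D x = ⁅x, w⁆ := hw ⟨x, hx⟩
    rw [LieDerivation.add_apply, this, LieDerivation.ad_apply_apply, ← lie_skew w x,
      add_neg_cancel]
  have hFit := LieModule.isCompl_genWeightSpace_zero_posFittingComp K k N
  obtain ⟨E, hE, P, hP, hEP⟩ := (LieSubmodule.mem_sup _ _ _).1
    (show (⟨_, hN⟩ : N) ∈ LieModule.genWeightSpace N (0 : k → K) ⊔ LieModule.posFittingComp K k N by
      rw [hFit.sup_eq_top]
      exact LieSubmodule.mem_top _)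
  have hpow : ∀ (y : k) (n : ℕ) (E : N),
      ((((LieModule.toEnd K k N y) ^ n) E : N) : LieDerivation K L L) =
        ((LieModule.toEnd K L (LieDerivation K L L) (y : L)) ^ n) E := fun y n => by
    induction n with
    | zero => exact fun E => rfl
    | succ n ih => exact fun E => by rw [pow_succ, pow_succ, Module.End.mul_apply, ih]; rfl
  have hE' : (E : LieDerivation K L L) ∈ derInv Γ := by
    refine T.mem_derInv_of_nilpotent E.2 fun y hy => ?_
    obtain ⟨n, h⟩ := (LieModule.mem_genWeightSpace N (0 : k → K) E).1 hE ⟨y, hy⟩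
    refine ⟨n, ?_⟩
    rw [Pi.zero_apply, zero_smul, sub_zero] at h
    rw [← hpow ⟨y, hy⟩, h]
    rfl
  have hP' : ∃ v, LieDerivation.ad K L v = P := by
    let R : Submodule K N := (LinearMap.range (LieDerivation.ad K L : L →ₗ[K] _)).comap
      N.toSubmodule.subtype
    have hle : (LieModule.posFittingComp K k N).toSubmodule ≤ R := by
      rw [LieModule.posFittingComp, LieSubmodule.iSup_toSubmodule]
      refine iSup_le fun y E hE => ?_
      obtain ⟨F, rfl⟩ := (LieModule.mem_posFittingCompOf K y E).1 hE 1
      refine ⟨-(F : LieDerivation K L L) (y : L), ?_⟩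
      refine LieDerivation.ext fun x => ?_
      rw [pow_one]
      change LieDerivation.ad K L _ x = ⁅x, (F : LieDerivation K L L) (y : L)⁆
      rw [LieDerivation.ad_apply_apply, neg_lie, lie_skew]
    exact hle hP
  obtain ⟨v, hv⟩ := hP'
  refine ⟨E, hE', v - w, ?_⟩
  have := congrArg Subtype.val hEP
  change (E : LieDerivation K L L) + P = D + LieDerivation.ad K L w at this
  rw [map_sub, hv, ← add_sub_assoc, this, add_sub_cancel_right]

theorem exists_ad_add_derInv_add_ad (T : IsGammaTriple Γ s k m) (D : LieDerivation K L L) :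
    ∃ x ∈ s, ∃ δ ∈ derInv Γ, ∃ z ∈ m, D = LieDerivation.ad K L x + δ + LieDerivation.ad K L z := by
  obtain ⟨δ, hδ, w, rfl⟩ := T.exists_derInv_add_ad D
  obtain ⟨x, hx, y, hy, z, hz, rfl⟩ := T.exists_add_add w
  refine ⟨x, hx, δ + LieDerivation.ad K L y, add_mem hδ (T.ad_mem_derInv hy), z, hz, ?_⟩
  rw [map_add, map_add]
  abel

theorem derInv_apply_mem_k (T : IsGammaTriple Γ s k m) {δ : LieDerivation K L L}
    (hδ : δ ∈ derInv Γ) {y : L} (hy : y ∈ k) : δ y ∈ k :=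
  T.mem_k_iff.2 fun γ hγ => by rw [← hδ γ hγ, T.apply_k hγ hy, map_zero]

/-- A derivation commuting with `Γ` preserves `m`: it maps `m = Γm` into `Γ` applied to the radical
`m + k`, which lies in `m`. -/
theorem derInv_apply_mem_m (T : IsGammaTriple Γ s k m) {δ : LieDerivation K L L}
    (hδ : δ ∈ derInv Γ) {z : L} (hz : z ∈ m) : δ z ∈ m := by
  have hle : movedPart Γ m ≤ m.comap (δ : L →ₗ[K] L) := movedPart_le fun γ hγ w hw => by
    change δ (γ w) ∈ m
    rw [hδ γ hγ]
    have hr : δ w ∈ m ⊔ k.toSubmodule := by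
      rw [T.sup_eq]
      refine derivation_apply_mem_radical δ ?_
      rw [← LieSubmodule.mem_toSubmodule, ← T.sup_eq]
      exact Submodule.mem_sup_left hw
    obtain ⟨v, hv, y, hy, h⟩ := Submodule.mem_sup.1 hr
    rw [← h, map_add, T.apply_k hγ hy, add_zero]
    exact T.apply_mem_m hγ hv
  exact hle (T.m_le_movedPart hz)

theorem derInv_apply_s (T : IsGammaTriple Γ s k m) {δ : LieDerivation K L L}
    (hδ : δ ∈ derInv Γ) {x : L} (hx : x ∈ s) : δ x = 0 := by
  refine T.eq_zero_of_map_lie (δ : L →ₗ[K] L) (fun a ha b hb => ?_) hx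
  have h₁ : ∀ a ∈ s, ∀ b, δ ⁅a, b⁆ = ⁅a, δ b⁆ := fun a ha b => hδ _ (T.ad_mem ha) b
  have h₂ := δ.apply_lie_eq_sub a b
  rw [h₁ a ha, ← h₁ b hb a] at h₂
  change δ ⁅a, b⁆ = 0
  rw [← lie_skew, map_neg, sub_eq_self.1 h₂.symm, neg_zero]

theorem derInv_apply_mem_nHat (T : IsGammaTriple Γ s k m) {δ : LieDerivation K L L}
    (hδ : δ ∈ derInv Γ) {w : L} (hw : w ∈ nHat m) : δ w ∈ nHat m := by
  refine LieSubalgebra.lieSpan_induction K (p := fun w _ => δ w ∈ nHat m) ?_ ?_ ?_ ?_ ?_ hw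
  · exact fun z hz => LieSubalgebra.subset_lieSpan (T.derInv_apply_mem_m hδ hz)
  · rw [map_zero]
    exact zero_mem _
  · intro a b _ _ ha hb
    rw [map_add]
    exact add_mem ha hb
  · intro c a _ ha
    rw [map_smul]
    exact (nHat m).smul_mem c ha
  · intro a b ha' hb' ha hb
    rw [δ.apply_lie_eq_sub]
    exact sub_mem ((nHat m).lie_mem ha' hb) ((nHat m).lie_mem hb' ha)

/-- The restriction `δ|_m` of a derivation `δ` commuting with `Γ`. -/
noncomputable def restrictM (T : IsGammaTriple Γ s k m) : derInv Γ →ₗ⁅K⁆ End K m where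
  toFun δ := ((δ : LieDerivation K L L) : End K L).restrict fun _ hz => T.derInv_apply_mem_m δ.2 hz
  map_add' _ _ := rfl
  map_smul' _ _ := rfl
  map_lie' := rfl

@[simp] theorem restrictM_apply (T : IsGammaTriple Γ s k m) (δ : derInv Γ) (z : m) :
    (T.restrictM δ z : L) = (δ : LieDerivation K L L) z := rfl

theorem restrictM_mem_algB (T : IsGammaTriple Γ s k m) (δ : derInv Γ) :
    T.restrictM δ ∈ algB Γ m := by
  refine ⟨⟨((δ : LieDerivation K L L) : End K L).restrict fun _ hw =>
    T.derInv_apply_mem_nHat δ.2 hw, fun a b => Subtype.ext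
      ((δ : LieDerivation K L L).apply_lie_eq_sub a b)⟩, ?_, fun z => rfl⟩
  intro γ hγ x y hxy
  change (δ : LieDerivation K L L) y = γ ((δ : LieDerivation K L L) x)
  rw [hxy, δ.2 γ hγ]

theorem mu_eq_restrictM (T : IsGammaTriple Γ s k m) (y : k) :
    T.mu y = T.restrictM ⟨LieDerivation.ad K L (y : L), T.ad_mem_derInv y.2⟩ := by
  refine LinearMap.ext fun z => Subtype.ext ?_
  simp

theorem range_mu_le_algB (T : IsGammaTriple Γ s k m) : T.mu.range ≤ algB Γ m := by
  rintro _ ⟨y, rfl⟩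
  have := T.restrictM_mem_algB ⟨LieDerivation.ad K L (y : L), T.ad_mem_derInv y.2⟩
  rwa [← T.mu_eq_restrictM] at this

theorem lie_restrictM_mu (T : IsGammaTriple Γ s k m) (δ : derInv Γ) (y : k) :
    ⁅T.restrictM δ, T.mu y⁆ =
      T.mu ⟨(δ : LieDerivation K L L) y, T.derInv_apply_mem_k δ.2 y.2⟩ := by
  refine LinearMap.ext fun z => Subtype.ext ?_
  simp only [Ring.lie_def, LinearMap.sub_apply, Module.End.mul_apply, AddSubgroupClass.coe_sub,
    restrictM_apply, mu_apply, LieDerivation.apply_lie_eq_add]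
  abel

theorem restrictM_mem_normB (T : IsGammaTriple Γ s k m) (δ : derInv Γ) :
    T.restrictM δ ∈ T.normB := by
  refine ⟨T.restrictM_mem_algB δ, ?_⟩
  refine (LieSubalgebra.mem_normalizer_iff _ _).2 ?_
  rintro _ ⟨y, rfl⟩
  exact ⟨_, (T.lie_restrictM_mu δ y).symm⟩

theorem restrictM_injective (T : IsGammaTriple Γ s k m) (hμ : Function.Injective T.mu) :
    Function.Injective T.restrictM := by
  refine (injective_iff_map_eq_zero _).2 fun δ hδ => Subtype.ext (LieDerivation.ext fun w => ?_)
  obtain ⟨x, hx, y, hy, z, hz, rfl⟩ := T.exists_add_add w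
  have hy0 : (δ : LieDerivation K L L) y = 0 := by
    have := T.lie_restrictM_mu δ ⟨y, hy⟩
    rw [hδ, zero_lie] at this
    exact congrArg Subtype.val (hμ (this.symm.trans (map_zero T.mu).symm))
  have hz0 : (δ : LieDerivation K L L) z = 0 :=
    congrArg Subtype.val (LinearMap.congr_fun hδ ⟨z, hz⟩)
  rw [map_add, map_add, T.derInv_apply_s δ.2 hx, hy0, hz0]
  simp

/-- Every `f ∈ N` extends to a derivation of `L` commuting with `Γ`: the extension vanishes on `s`
and is `μ⁻¹ ∘ [f, ·] ∘ μ` on `k`. For brackets of elements of `m`, it is compared on `k ∩ n̂` with a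
derivation of `n̂` that extends `f`. -/
theorem exists_restrictM_eq (T : IsGammaTriple Γ s k m) (hμ : Function.Injective T.mu)
    {f : End K m} (hf : f ∈ T.normB) : ∃ δ, T.restrictM δ = f := by
  obtain ⟨⟨ε, hε, hεf⟩, hnorm⟩ := hf
  have hex : ∀ y : k, ∃ y' : k, T.mu y' = ⁅f, T.mu y⁆ := fun y =>
    (LieSubalgebra.mem_normalizer_iff _ f).1 hnorm _ ⟨y, rfl⟩
  choose g hg using hex
  let G : k →ₗ[K] k :=
    { toFun := g
      map_add' := fun a b => hμ (by rw [hg, map_add, map_add, hg, hg, lie_add])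
      map_smul' := fun c a => hμ (by rw [hg, map_smul, RingHom.id_apply, map_smul, hg, Ring.lie_def,
        Ring.lie_def, mul_smul_comm, smul_mul_assoc, smul_sub]) }
  have hG : ∀ y, T.mu (G y) = ⁅f, T.mu y⁆ := hg
  have hGm : ∀ (y : k) (z : m), ⁅(G y : L), (z : L)⁆ = f (T.mu y z) - ⁅(y : L), (f z : L)⁆ :=
    fun y z => congrArg Subtype.val (LinearMap.congr_fun (hG y) z)
  let D : End K L := k.toSubmodule.subtype ∘ₗ G ∘ₗ T.projK + m.subtype ∘ₗ f ∘ₗ T.projM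
  have hD : ∀ {x y z : L} (_ : x ∈ s) (hy : y ∈ k) (hz : z ∈ m),
      D (x + y + z) = G ⟨y, hy⟩ + f ⟨z, hz⟩ := fun {x y z} hx hy hz => by
    rw [← T.projK_add_add hx hy hz, ← T.projM_add_add hx hy hz]
    rfl
  have hDs : ∀ x ∈ s, D x = 0 := fun x hx => by
    have := hD hx k.zero_mem m.zero_mem
    rw [add_zero, add_zero] at this
    rw [this, show (⟨0, k.zero_mem⟩ : k) = 0 from rfl, show (⟨0, m.zero_mem⟩ : m) = 0 from rfl,
      map_zero, map_zero]
    exact add_zero 0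
  have hDk : ∀ y (hy : y ∈ k), D y = G ⟨y, hy⟩ := fun y hy => by
    have := hD s.zero_mem hy m.zero_mem
    rw [add_zero, zero_add] at this
    rw [this, show (⟨0, m.zero_mem⟩ : m) = 0 from rfl, map_zero]
    exact add_zero _
  have hDm : ∀ z (hz : z ∈ m), D z = f ⟨z, hz⟩ := fun z hz => by
    have := hD s.zero_mem k.zero_mem hz
    rw [zero_add, zero_add] at this
    rw [this, show (⟨0, k.zero_mem⟩ : k) = 0 from rfl, map_zero]
    exact zero_add _
  have hεγ : ∀ γ (hγ : γ ∈ Γ) z (hz : z ∈ m),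
      (f ⟨γ z, T.apply_mem_m hγ hz⟩ : L) = γ (f ⟨z, hz⟩) :=
    fun γ hγ z hz => by
      have := hε γ hγ (toHat ⟨z, hz⟩) (toHat ⟨γ z, T.apply_mem_m hγ hz⟩) rfl
      rw [hεf, hεf] at this
      exact this
  have hDγ : ∀ γ ∈ Γ, ∀ w, D (γ w) = γ (D w) := fun γ hγ w => by
    obtain ⟨x, hx, y, hy, z, hz, rfl⟩ := T.exists_add_add w
    simp only [map_add]
    rw [T.apply_k hγ hy, map_zero, hDs _ (T.apply_mem_s hγ hx), hDs x hx, map_zero,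
      hDk y hy, T.apply_k hγ (G ⟨y, hy⟩).2, hDm _ (T.apply_mem_m hγ hz), hDm z hz, hεγ γ hγ]
  have hcomm : ∀ x ∈ s, ∀ w, D ⁅x, w⁆ = ⁅x, D w⁆ := fun x hx w => hDγ _ (T.ad_mem hx) w
  -- On `k ∩ n̂` the extension agrees with `ε`.
  have hεk : ∀ c : nHat m, ∀ hc : (c : L) ∈ k, (ε c : L) = G ⟨c, hc⟩ := fun c hc => by
    have hmem : (ε c : L) ∈ k := T.mem_k_iff.2 fun γ hγ => by
      have := hε γ hγ c 0 (T.apply_k hγ hc).symm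
      rw [map_zero] at this
      exact this.symm
    refine congrArg Subtype.val (show (⟨ε c, hmem⟩ : k) = G ⟨c, hc⟩ from hμ ?_)
    rw [hG]
    refine LinearMap.ext fun z => Subtype.ext ?_
    have h₁ := congrArg Subtype.val (ε.apply_lie_eq_add c (toHat z))
    have h₂ : ⁅c, toHat z⁆ = toHat (T.mu ⟨c, hc⟩ z) := rfl
    rw [h₂, hεf, hεf] at h₁
    change (f (T.mu ⟨c, hc⟩ z) : L) = ⁅(c : L), (f z : L)⁆ + ⁅(ε c : L), (z : L)⁆ at h₁
    change ⁅(ε c : L), (z : L)⁆ = f (T.mu ⟨c, hc⟩ z) - ⁅(c : L), (f z : L)⁆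
    rw [h₁, add_sub_cancel_left]
  have hleib : ∀ a b, D ⁅a, b⁆ = ⁅a, D b⁆ - ⁅b, D a⁆ := by
    refine T.leibniz_of_cases D ?_ ?_ ?_ ?_ ?_ ?_
    · intro a ha b hb
      rw [hcomm a ha, hDs a ha, lie_zero, sub_zero]
    · intro a ha b hb
      rw [hcomm a ha, hDs a ha, lie_zero, sub_zero]
    · intro a ha b hb
      rw [hcomm a ha, hDs a ha, lie_zero, sub_zero]
    · intro a ha b hb
      rw [hDk _ (k.lie_mem ha hb), hDk a ha, hDk b hb]
      have : G ⁅(⟨a, ha⟩ : k), ⟨b, hb⟩⁆ = ⁅(⟨a, ha⟩ : k), G ⟨b, hb⟩⁆ - ⁅(⟨b, hb⟩ : k), G ⟨a, ha⟩⁆ := by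
        refine hμ ?_
        rw [hG, map_sub, LieHom.map_lie, LieHom.map_lie, LieHom.map_lie, hG, hG, leibniz_lie,
          ← lie_skew (T.mu ⟨b, hb⟩)]
        abel
      exact congrArg Subtype.val this
    · intro a ha b hb
      rw [hDm _ (T.lie_k_m ha hb), hDk a ha, hDm b hb, ← lie_skew b, hGm ⟨a, ha⟩ ⟨b, hb⟩]
      change (f (T.mu ⟨a, ha⟩ ⟨b, hb⟩) : L) = _
      abel
    · intro a ha b hb
      obtain ⟨y, hy, v, hv, hab⟩ := T.exists_lie_eq_add a hb
      let c : nHat m := ⁅toHat ⟨a, ha⟩, toHat ⟨b, hb⟩⁆ - toHat ⟨v, hv⟩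
      have hcy : (c : L) = y := by
        change ⁅a, b⁆ - v = y
        rw [hab, add_sub_cancel_right]
      have hck : (c : L) ∈ k := hcy ▸ hy
      have h₁ := hεk c hck
      have h₂ := congrArg Subtype.val (ε.apply_lie_eq_sub (toHat ⟨a, ha⟩) (toHat ⟨b, hb⟩))
      rw [hεf, hεf] at h₂
      change _ = ⁅a, (f ⟨b, hb⟩ : L)⁆ - ⁅b, (f ⟨a, ha⟩ : L)⁆ at h₂
      have h₃ : (ε c : L) = (ε ⁅toHat ⟨a, ha⟩, toHat ⟨b, hb⟩⁆ : L) - f ⟨v, hv⟩ := by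
        rw [map_sub, hεf]
        rfl
      rw [hab, map_add, hDk y hy, hDm v hv, hDm a ha, hDm b hb, ← h₂,
        show (⟨y, hy⟩ : k) = ⟨c, hck⟩ from Subtype.ext hcy.symm, ← h₁, h₃, sub_add_cancel]
  exact ⟨⟨⟨D, hleib⟩, hDγ⟩, LinearMap.ext fun z => Subtype.ext (hDm z z.2)⟩

end Derivations

end IsGammaTriple

/-! ### The structure of `Der L` -/

theorem isLieLaw_of_map_lie {K A M : Type*} [Field K] [AddCommGroup A] [Module K A] [LieRing M]
    [LieAlgebra K M] (e : M ≃ₗ[K] A) (Φ : A →ₗ[K] A →ₗ[K] A)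
    (h : ∀ D E, e ⁅D, E⁆ = Φ (e D) (e E)) : IsLieLaw Φ := by
  refine ⟨fun a => ?_, fun a b c => ?_⟩
  · obtain ⟨D, rfl⟩ := e.surjective a
    rw [← h, lie_self, map_zero]
  · obtain ⟨D, rfl⟩ := e.surjective a
    obtain ⟨E, rfl⟩ := e.surjective b
    obtain ⟨F, rfl⟩ := e.surjective c
    rw [← h, ← h, ← h, ← h, ← h, ← h, ← map_add, ← map_add, lie_jacobi, map_zero]

namespace IsGammaTriple

section Structure

open Module

variable {K L : Type*} [Field K] [CharZero K] [LieRing L] [LieAlgebra K L] [FiniteDimensional K L]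
variable {Γ : LieSubalgebra K (End K L)} {s k : LieSubalgebra K L} {m : Submodule K L}

theorem center_le_k (T : IsGammaTriple Γ s k m) {w : L} (hw : w ∈ LieAlgebra.center K L) :
    w ∈ k := by
  have hc : ∀ v : L, ⁅v, w⁆ = 0 := hw
  refine T.mem_k_iff.2 fun γ hγ => ?_
  obtain ⟨x, -, y, -, u, hu, rfl⟩ := (T.mem_iff γ).1 hγ
  rw [LinearMap.add_apply, LieAlgebra.ad_apply, hc, zero_add]
  exact hu.apply_eq_zero (n := 1) (by rw [pow_one, LieAlgebra.ad_apply, hc])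

/-- A central element is killed by `Γ`, hence lies in `k` and in the kernel of `μ`. Conversely the kernel of
`μ` is an ideal of `k` whose intersection with the center of `k` is central in `L`. -/
theorem mu_injective_iff (T : IsGammaTriple Γ s k m) :
    Function.Injective T.mu ↔ LieAlgebra.center K L = ⊥ := by
  constructor
  · intro hμ
    refine (LieSubmodule.eq_bot_iff _).2 fun w hw => ?_
    have hc : ∀ v : L, ⁅v, w⁆ = 0 := hw
    have h₀ : T.mu ⟨w, T.center_le_k hw⟩ = T.mu 0 := by
      rw [map_zero]
      refine LinearMap.ext fun z => Subtype.ext ?_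
      rw [mu_apply, ← lie_skew, hc, neg_zero]
      rfl
    exact congrArg Subtype.val (hμ h₀)
  · intro hZ
    have hn := T.nilpotent
    refine (LieHom.ker_eq_bot T.mu).1 (by_contra fun hne => hne ?_)
    -- A nonzero ideal of the nilpotent algebra `k` would meet the center of `k`.
    have : Nontrivial T.mu.ker := (LieSubmodule.nontrivial_iff_ne_bot K k k).2 hne
    have : LieModule.IsNilpotent k T.mu.ker :=
      (LieSubmodule.injective_incl T.mu.ker).lieModuleIsNilpotent
        (f := (LieHom.id : k →ₗ⁅K⁆ k)) fun _ _ => rfl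
    have := LieModule.nontrivial_max_triv_of_isNilpotent K k T.mu.ker
    obtain ⟨⟨y, hy⟩, hy0⟩ := exists_ne (0 : LieModule.maxTrivSubmodule K k T.mu.ker)
    refine absurd (Subtype.ext (Subtype.ext (Subtype.ext ?_))) hy0
    have hyk : ∀ v ∈ k, ⁅v, ((y : k) : L)⁆ = 0 := fun v hv =>
      congrArg (fun a : T.mu.ker => ((a : k) : L)) (hy ⟨v, hv⟩)
    have hym : ∀ z ∈ m, ⁅((y : k) : L), z⁆ = 0 := fun z hz =>
      congrArg Subtype.val (LinearMap.congr_fun (LieHom.mem_ker.1 y.2) ⟨z, hz⟩)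
    have hc : ((y : k) : L) ∈ LieAlgebra.center K L := fun v => by
      obtain ⟨x, hx, v, hv, z, hz, rfl⟩ := T.exists_add_add v
      rw [add_lie, add_lie, T.lie_s_k x hx _ (y : k).2, hyk v hv, ← lie_skew, hym z hz]
      simp
    rw [hZ] at hc
    exact (LieSubmodule.mem_bot _).1 hc

/-- The isomorphism `Θ : δ ↦ δ|_m` of `(Der L)^Γ` onto `N`. -/
noncomputable def theta (T : IsGammaTriple Γ s k m) (hμ : Function.Injective T.mu) :
    derInv Γ ≃ₗ⁅K⁆ T.normB :=
  LieEquiv.ofBijective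
    { toFun := fun δ => ⟨T.restrictM δ, T.restrictM_mem_normB δ⟩
      map_add' := fun δ ε => Subtype.ext (map_add T.restrictM δ ε)
      map_smul' := fun c δ => Subtype.ext (map_smul T.restrictM c δ)
      map_lie' := fun {δ ε} => Subtype.ext (LieHom.map_lie T.restrictM δ ε) }
    ⟨fun δ ε h => T.restrictM_injective hμ (congrArg Subtype.val h), fun f => by
      obtain ⟨δ, hδ⟩ := T.exists_restrictM_eq hμ f.2
      exact ⟨δ, Subtype.ext hδ⟩⟩

theorem theta_apply (T : IsGammaTriple Γ s k m) (hμ : Function.Injective T.mu) (δ : derInv Γ)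
    (z : m) : (((T.theta hμ δ : End K m) z : m) : L) = (δ : LieDerivation K L L) (z : L) := rfl

theorem theta_symm_apply (T : IsGammaTriple Γ s k m) (hμ : Function.Injective T.mu) (f : T.normB)
    (z : m) : ((T.theta hμ).symm f : LieDerivation K L L) (z : L) = (f : End K m) z := by
  rw [← T.theta_apply hμ, LieEquiv.apply_symm_apply]

theorem theta_symm_eq_ad (T : IsGammaTriple Γ s k m) (hμ : Function.Injective T.mu) {f : T.normB}
    {y : k} (h : (f : End K m) = T.mu y) :
    ((T.theta hμ).symm f : LieDerivation K L L) = LieDerivation.ad K L (y : L) := by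
  have : (T.theta hμ).symm f = ⟨LieDerivation.ad K L (y : L), T.ad_mem_derInv y.2⟩ := by
    rw [LieEquiv.symm_apply_eq]
    exact Subtype.ext (h.trans (T.mu_eq_restrictM y))
  rw [this]

/-- The map `(x, y, z) ↦ ad x + Θ⁻¹(y) + ad z`. -/
noncomputable def toDer (T : IsGammaTriple Γ s k m) (hμ : Function.Injective T.mu) :
    (s × T.normB × m) →ₗ[K] LieDerivation K L L where
  toFun v := LieDerivation.ad K L (v.1 : L) + ((T.theta hμ).symm v.2.1 : LieDerivation K L L) +
    LieDerivation.ad K L (v.2.2 : L)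
  map_add' v w := by
    simp only [Prod.fst_add, Prod.snd_add, map_add, AddMemClass.coe_add]
    abel
  map_smul' c v := by
    simp only [Prod.smul_fst, Prod.smul_snd, map_smul, SetLike.val_smul, smul_add,
      RingHom.id_apply]

theorem toDer_apply (T : IsGammaTriple Γ s k m) (hμ : Function.Injective T.mu) (x : s)
    (y : T.normB) (z : m) : T.toDer hμ (x, y, z) =
      LieDerivation.ad K L (x : L) + ((T.theta hμ).symm y : LieDerivation K L L) +
        LieDerivation.ad K L (z : L) := rfl

theorem toDer_bijective (T : IsGammaTriple Γ s k m) (hμ : Function.Injective T.mu) :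
    Function.Bijective (T.toDer hμ) := by
  constructor
  · refine (injective_iff_map_eq_zero _).2 ?_
    rintro ⟨x, y, z⟩ h
    rw [toDer_apply] at h
    have hmem : LieDerivation.ad K L ((x : L) + z) ∈ derInv Γ := by
      have : LieDerivation.ad K L ((x : L) + z) =
          -((T.theta hμ).symm y : LieDerivation K L L) := by
        rw [map_add, eq_neg_iff_add_eq_zero, ← h]
        abel
      rw [this]
      exact neg_mem ((T.theta hμ).symm y).2
    have hk := T.mem_k_of_ad_mem_derInv (T.mu_injective_iff.1 hμ) hmem
    obtain ⟨hx, -, hz⟩ := T.eq_zero_of_add_add_eq_zero x.2 (neg_mem hk) z.2 (by abel)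
    rw [hx, hz, map_zero, add_zero, zero_add] at h
    have hy : (T.theta hμ).symm y = 0 := Subtype.ext h
    rw [LieEquiv.symm_apply_eq] at hy
    exact Prod.ext (Subtype.ext hx) (Prod.ext (hy.trans (map_zero (T.theta hμ))) (Subtype.ext hz))
  · intro D
    obtain ⟨x, hx, δ, hδ, z, hz, rfl⟩ := T.exists_ad_add_derInv_add_ad D
    refine ⟨(⟨x, hx⟩, T.theta hμ ⟨δ, hδ⟩, ⟨z, hz⟩), ?_⟩
    rw [toDer_apply, LieEquiv.symm_apply_apply]

/-- The identification of `Der L` with `s × N × m`. -/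
noncomputable def derEquiv (T : IsGammaTriple Γ s k m) (hμ : Function.Injective T.mu) :
    LieDerivation K L L ≃ₗ[K] (s × T.normB × m) :=
  (LinearEquiv.ofBijective (T.toDer hμ) (T.toDer_bijective hμ)).symm

theorem derEquiv_symm_apply (T : IsGammaTriple Γ s k m) (hμ : Function.Injective T.mu)
    (v : s × T.normB × m) : (T.derEquiv hμ).symm v = T.toDer hμ v := rfl

/-- The bracket of `s × N × m` transported from `Der L`. -/
noncomputable def bracket (T : IsGammaTriple Γ s k m) (hμ : Function.Injective T.mu) :
    (s × T.normB × m) →ₗ[K] (s × T.normB × m) →ₗ[K] (s × T.normB × m) :=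
  LinearMap.mk₂ K (fun v w => T.derEquiv hμ ⁅T.toDer hμ v, T.toDer hμ w⁆)
    (fun _ _ _ => by rw [map_add, add_lie, map_add])
    (fun _ _ _ => by rw [map_smul, smul_lie, map_smul])
    (fun _ _ _ => by rw [map_add, lie_add, map_add])
    (fun c v w => by
      rw [map_smul]
      exact (congrArg _ (lie_smul c (T.toDer hμ v) (T.toDer hμ w))).trans (map_smul _ c _))

theorem bracket_eq_iff (T : IsGammaTriple Γ s k m) (hμ : Function.Injective T.mu)
    {u v w : s × T.normB × m} :
    T.bracket hμ v w = u ↔ ⁅T.toDer hμ v, T.toDer hμ w⁆ = T.toDer hμ u := by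
  rw [← derEquiv_symm_apply T hμ u, LinearEquiv.eq_symm_apply]
  rfl

theorem derEquiv_lie (T : IsGammaTriple Γ s k m) (hμ : Function.Injective T.mu)
    (D E : LieDerivation K L L) :
    T.derEquiv hμ ⁅D, E⁆ = T.bracket hμ (T.derEquiv hμ D) (T.derEquiv hμ E) := by
  symm
  rw [bracket_eq_iff]
  simp only [← derEquiv_symm_apply, LinearEquiv.symm_apply_apply]

theorem lie_ad_s_theta_symm (T : IsGammaTriple Γ s k m) (hμ : Function.Injective T.mu) {x : L}
    (hx : x ∈ s) (y : T.normB) :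
    ⁅LieDerivation.ad K L x, ((T.theta hμ).symm y : LieDerivation K L L)⁆ = 0 := by
  rw [← lie_skew, LieDerivation.lie_der_ad_eq_ad_der,
    T.derInv_apply_s ((T.theta hμ).symm y).2 hx, map_zero, neg_zero]

theorem bracket_s (T : IsGammaTriple Γ s k m) (hμ : Function.Injective T.mu) (x₁ x₂ : s)
    (y₂ : T.normB) (z₂ : m) : T.bracket hμ (x₁, 0, 0) (x₂, y₂, z₂) =
      (⁅x₁, x₂⁆, 0, ⟨⁅(x₁ : L), (z₂ : L)⁆, T.lie_s_m x₁.2 z₂.2⟩) := by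
  rw [bracket_eq_iff]
  simp only [toDer_apply, map_zero, ZeroMemClass.coe_zero, add_zero, lie_add,
    T.lie_ad_s_theta_symm hμ x₁.2, ← LieHom.map_lie, LieSubalgebra.coe_bracket]

theorem bracket_normB (T : IsGammaTriple Γ s k m) (hμ : Function.Injective T.mu)
    (y₁ y₂ : T.normB) (z₂ : m) : T.bracket hμ (0, y₁, 0) (0, y₂, z₂) =
      (0, ⁅y₁, y₂⁆, (y₁ : End K m) z₂) := by
  rw [bracket_eq_iff]
  simp only [toDer_apply, map_zero, ZeroMemClass.coe_zero, add_zero, zero_add, lie_add,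
    LieDerivation.lie_der_ad_eq_ad_der, LieEquiv.map_lie, LieSubalgebra.coe_bracket,
    theta_symm_apply]

theorem bracket_m (T : IsGammaTriple Γ s k m) (hμ : Function.Injective T.mu) (z₁ z₂ : m) :
    (T.bracket hμ (0, 0, z₁) (0, 0, z₂)).1 = 0 ∧
    ((T.bracket hμ (0, 0, z₁) (0, 0, z₂)).2.1 : End K m) =
      T.mu (T.projK ⁅(z₁ : L), (z₂ : L)⁆) ∧
    (T.bracket hμ (0, 0, z₁) (0, 0, z₂)).2.2 = T.projM ⁅(z₁ : L), (z₂ : L)⁆ := by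
  obtain ⟨y, hy, v, hv, h⟩ := T.exists_lie_eq_add (z₁ : L) z₂.2
  have hK : T.projK ⁅(z₁ : L), (z₂ : L)⁆ = ⟨y, hy⟩ := by
    rw [h, ← T.projK_add_add s.zero_mem hy hv, zero_add]
  have hM : T.projM ⁅(z₁ : L), (z₂ : L)⁆ = ⟨v, hv⟩ := by
    rw [h, ← T.projM_add_add s.zero_mem hy hv, zero_add]
  have hmem : T.mu ⟨y, hy⟩ ∈ T.normB :=
    T.mu_eq_restrictM ⟨y, hy⟩ ▸ T.restrictM_mem_normB _
  have : T.bracket hμ (0, 0, z₁) (0, 0, z₂) = (0, ⟨T.mu ⟨y, hy⟩, hmem⟩, ⟨v, hv⟩) := by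
    rw [bracket_eq_iff]
    simp only [toDer_apply, map_zero, ZeroMemClass.coe_zero, zero_add, ← LieHom.map_lie, h,
      map_add, T.theta_symm_eq_ad hμ (f := ⟨T.mu ⟨y, hy⟩, hmem⟩) rfl]
  rw [this, hK, hM]
  exact ⟨rfl, rfl, rfl⟩

theorem isComplete_iff (T : IsGammaTriple Γ s k m) (hμ : Function.Injective T.mu) :
    IsComplete K L ↔ T.mu.range = T.normB := by
  have hZ := T.mu_injective_iff.1 hμ
  constructor
  · rintro ⟨-, hD⟩
    refine le_antisymm ?_ fun f hf => ?_
    · rintro _ ⟨y, rfl⟩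
      have := T.restrictM_mem_normB ⟨LieDerivation.ad K L (y : L), T.ad_mem_derInv y.2⟩
      rwa [← T.mu_eq_restrictM] at this
    · obtain ⟨δ, rfl⟩ := T.exists_restrictM_eq hμ hf
      obtain ⟨w, hw⟩ := hD δ
      have hk := T.mem_k_of_ad_mem_derInv hZ (hw ▸ δ.2)
      refine ⟨⟨w, hk⟩, (T.mu_eq_restrictM ⟨w, hk⟩).trans ?_⟩
      exact congrArg T.restrictM (Subtype.ext hw.symm)
  · intro h
    refine ⟨hZ, fun D => ?_⟩
    obtain ⟨⟨x, f, z⟩, rfl⟩ := (T.toDer_bijective hμ).2 D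
    obtain ⟨y, hy⟩ : (f : End K m) ∈ T.mu.range := by
      rw [h]
      exact f.2
    refine ⟨(x : L) + y + z, ?_⟩
    rw [toDer_apply, T.theta_symm_eq_ad hμ (f := f) hy.symm, map_add, map_add]

end Structure

end IsGammaTriple

end GammaDecomp

theorem mainTheorem2 {K L : Type*} [Field K] [CharZero K] [LieRing L] [LieAlgebra K L]
    [FiniteDimensional K L] (Γ : LieSubalgebra K (Module.End K L)) (s k : LieSubalgebra K L)
    (m : Submodule K L) (T : GammaDecomp.IsGammaTriple Γ s k m) :
    (Function.Injective T.mu ↔ LieAlgebra.center K L = ⊥) ∧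
    (Function.Injective T.mu →
      T.mu.range ≤ GammaDecomp.algB Γ m ∧
      (∃ Θ : GammaDecomp.derInv Γ ≃ₗ⁅K⁆ T.normB,
        (∀ (δ : GammaDecomp.derInv Γ) (z : m),
          (((Θ δ : Module.End K m) z : m) : L) = (δ : LieDerivation K L L) (z : L)) ∧
        ∃ Φ : (s × T.normB × m) →ₗ[K] (s × T.normB × m) →ₗ[K] (s × T.normB × m),
          GammaDecomp.IsLieLaw Φ ∧
          (∀ (x₁ x₂ : s) (y₂ : T.normB) (z₂ : m),
            Φ (x₁, 0, 0) (x₂, y₂, z₂) =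
              (⁅x₁, x₂⁆, 0, ⟨⁅(x₁ : L), (z₂ : L)⁆, T.lie_s_m x₁.2 z₂.2⟩)) ∧
          (∀ (y₁ y₂ : T.normB) (z₂ : m),
            Φ (0, y₁, 0) (0, y₂, z₂) = (0, ⁅y₁, y₂⁆, (y₁ : Module.End K m) z₂)) ∧
          (∀ z₁ z₂ : m,
            (Φ (0, 0, z₁) (0, 0, z₂)).1 = 0 ∧
            ((Φ (0, 0, z₁) (0, 0, z₂)).2.1 : Module.End K m) =
              T.mu (T.projK ⁅(z₁ : L), (z₂ : L)⁆) ∧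
            (Φ (0, 0, z₁) (0, 0, z₂)).2.2 = T.projM ⁅(z₁ : L), (z₂ : L)⁆) ∧
          ∃ e : LieDerivation K L L ≃ₗ[K] (s × T.normB × m),
            (∀ D E : LieDerivation K L L, e ⁅D, E⁆ = Φ (e D) (e E)) ∧
            (∀ (x : s) (y : T.normB) (z : m),
              e.symm (x, y, z) =
                LieDerivation.ad K L (x : L) + (Θ.symm y : LieDerivation K L L) +
                  LieDerivation.ad K L (z : L))) ∧
      (GammaDecomp.IsComplete K L ↔ T.mu.range = T.normB)) := by
  refine ⟨T.mu_injective_iff, fun hμ => ⟨T.range_mu_le_algB, ⟨T.theta hμ, T.theta_apply hμ,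
    T.bracket hμ, GammaDecomp.isLieLaw_of_map_lie (T.derEquiv hμ) _ (T.derEquiv_lie hμ),
    T.bracket_s hμ, T.bracket_normB hμ, T.bracket_m hμ, T.derEquiv hμ, T.derEquiv_lie hμ,
    fun x y z => rfl⟩, T.isComplete_iff hμ⟩⟩
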